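/- A graph is a finite set of flags (half-edges) together with an involution of the flags, a finite set of vertices, and a map attaching each flag to a vertex; the fixed points of the involution are the legs and its two-element orbits are the edges (loops and multiple edges are allowed). A stable graph of genus $g$ with $n$ legs is a non-empty connected graph with exactly $n$ legs, numbered $1,\dots,n$, and a genus $g(v)\in\mathbb{Z}_{\ge0}$ for each vertex $v$, such that $2(g(v)-1)+n(v)>0$ for each vertex $v$, where $n(v)$ is the number of flags at $v$, and such that $g=b_1+\sum_v g(v)$, where $b_1=|\mathrm{Edges}|-|\mathrm{Vertices}|+1$ is the first Betti number of the graph. Isomorphisms are pairs of bijections of flags and of vertices that preserve all of these data, including the numbering of the legs. Proposition. For $n\ge1$ let $\Gamma^0_{1,n}$ be the set of isomorphism classes of stable graphs of genus $1$ with $n$ legs all of whose vertices have genus $0$. Then $\Gamma^0_{1,n}$ is finite for every $n\ge1$, and, as formal power series in $x$ with rational coefficients, $$ \sum_{n=1}^\infty |\Gamma^0_{1,n}| \frac{x^n}{n!} = \Bigl( - \frac{1}{2} \log \bigl( 2 - e^x \bigr) + \frac{1}{4} \bigl(e^{2x}-1\bigr) \Bigr) \circ \bigl(1+2x-e^x\bigr)^{-1},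 $$ where $\circ$ is composition of power series and $(1+2x-e^x)^{-1}$ is the compositional inverse of $1+2x-e^x=x-\frac{x^2}{2}-\cdots$. -/

import Mathlib

/-- A connected labelled graph with `n` totally ordered legs: a finite set of flags (half-edges)
with an involution, each flag being attached to a vertex, and each vertex having a genus.
The fixed points of the involution are the legs, numbered by `Fin n`;
its orbits with two elements are the edges (so loops and multiple edges are allowed). -/
structure LabelledGraph (n : ℕ) where
  Vert : Type
  Flag : Type
  [fintypeVert : Fintype Vert]
  [fintypeFlag : Fintype Flag]
  /-- the vertex to which a flag is attached -/
  root : Flag → Vert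
  inv : Flag → Flag
  inv_inv : ∀ h, inv (inv h) = h
  /-- the numbering of the legs -/
  leg : Fin n ≃ {h : Flag // inv h = h}
  /-- the genus of a vertex -/
  vgenus : Vert → ℕ
  nonempty : Nonempty Vert
  connected : ∀ v w : Vert,
    Relation.ReflTransGen (fun a b => ∃ h, root h = a ∧ root (inv h) = b) v w

namespace LabelledGraph

attribute [instance] LabelledGraph.fintypeVert LabelledGraph.fintypeFlag

variable {n : ℕ}

/-- The edges: the two-element orbits of the involution. -/
def Edge (G : LabelledGraph n) : Type :=
  {e : Set G.Flag // ∃ h, G.inv h ≠ h ∧ e = {h, G.inv h}}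

/-- The valence of a vertex: the number of flags (legs included) attached to it. -/
noncomputable def valence (G : LabelledGraph n) (v : G.Vert) : ℕ :=
  Nat.card {h : G.Flag // G.root h = v}

/-- The genus of a (connected) graph: its first Betti number `|Edge| - |Vert| + 1`
plus the sum of the genera of the vertices. -/
noncomputable def genus (G : LabelledGraph n) : ℤ :=
  (Nat.card G.Edge : ℤ) - (Nat.card G.Vert : ℤ) + 1 + ∑ v, (G.vgenus v : ℤ)

/-- Stability: `2 (g(v) - 1) + n(v) > 0` for every vertex `v`. -/
def IsStable (G : LabelledGraph n) : Prop :=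
  ∀ v, 0 < 2 * ((G.vgenus v : ℤ) - 1) + (G.valence v : ℤ)

/-- Isomorphisms preserve all the data, including the numbering of the legs. -/
structure Iso (G G' : LabelledGraph n) where
  vert : G.Vert ≃ G'.Vert
  flag : G.Flag ≃ G'.Flag
  root_flag : ∀ h, G'.root (flag h) = vert (G.root h)
  inv_flag : ∀ h, G'.inv (flag h) = flag (G.inv h)
  leg_flag : ∀ i, flag (G.leg i : G.Flag) = (G'.leg i : G'.Flag)
  vgenus_vert : ∀ v, G'.vgenus (vert v) = G.vgenus v

/-- The identity isomorphism. -/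
def Iso.refl (G : LabelledGraph n) : Iso G G where
  vert := Equiv.refl _
  flag := Equiv.refl _
  root_flag _ := rfl
  inv_flag _ := rfl
  leg_flag _ := rfl
  vgenus_vert _ := rfl

/-- The inverse of an isomorphism. -/
def Iso.symm {G G' : LabelledGraph n} (e : Iso G G') : Iso G' G where
  vert := e.vert.symm
  flag := e.flag.symm
  root_flag h := by
    have := e.root_flag (e.flag.symm h)
    rw [Equiv.apply_symm_apply] at this
    rw [this, Equiv.symm_apply_apply]
  inv_flag h := by
    have := e.inv_flag (e.flag.symm h)
    rw [Equiv.apply_symm_apply] at this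
    rw [this, Equiv.symm_apply_apply]
  leg_flag i := by rw [← e.leg_flag i, Equiv.symm_apply_apply]
  vgenus_vert v := by
    have := e.vgenus_vert (e.vert.symm v)
    rw [Equiv.apply_symm_apply] at this
    exact this.symm

/-- The composition of isomorphisms. -/
def Iso.trans {G G' G'' : LabelledGraph n} (e : Iso G G') (f : Iso G' G'') : Iso G G'' where
  vert := e.vert.trans f.vert
  flag := e.flag.trans f.flag
  root_flag h := by simp [f.root_flag, e.root_flag]
  inv_flag h := by simp [f.inv_flag, e.inv_flag]
  leg_flag i := by simp [f.leg_flag, e.leg_flag]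
  vgenus_vert v := by simp [f.vgenus_vert, e.vgenus_vert]

end LabelledGraph

/-- Stable graphs of genus `g` with `n` totally ordered legs. -/
def StableGraph (g n : ℕ) : Type 1 :=
  {G : LabelledGraph n // G.IsStable ∧ G.genus = (g : ℤ)}

/-- Isomorphism of stable graphs, as an equivalence relation. -/
instance StableGraph.isoSetoid (g n : ℕ) : Setoid (StableGraph g n) where
  r G G' := Nonempty (LabelledGraph.Iso G.1 G'.1)
  iseqv :=
    { refl := fun G => ⟨LabelledGraph.Iso.refl G.1⟩
      symm := fun ⟨e⟩ => ⟨e.symm⟩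
      trans := fun ⟨e⟩ ⟨f⟩ => ⟨e.trans f⟩ }

/-- `Γ_{g,n}`: isomorphism classes of stable graphs of genus `g` with `n` ordered legs. -/
def StableGraphClass (g n : ℕ) : Type 1 :=
  Quotient (StableGraph.isoSetoid g n)

/-- `Γ⁰_{g,n}`: the classes of stable graphs all of whose vertices have genus `0`. -/
def genusZeroVertexClasses (g n : ℕ) : Set (StableGraphClass g n) :=
  {c | ∃ G : StableGraph g n, Quotient.mk _ G = c ∧ ∀ v, G.1.vgenus v = 0}

/-- The formal power series `1 + 2x - e^x`. -/
noncomputable def innerSeries : PowerSeries ℚ :=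
  1 + 2 * PowerSeries.X - PowerSeries.exp ℚ

theorem constantCoeff_innerSeries : PowerSeries.constantCoeff innerSeries = 0 := by
  simp [innerSeries]

theorem isUnit_coeff_one_innerSeries : IsUnit (PowerSeries.coeff 1 innerSeries) := by
  have h : PowerSeries.coeff 1 innerSeries = 1 := by
    have h2 : (2 : PowerSeries ℚ) = PowerSeries.C (2 : ℚ) := (map_ofNat PowerSeries.C 2).symm
    rw [innerSeries, h2]
    simp [PowerSeries.coeff_one, PowerSeries.coeff_exp]
    norm_num
  rw [h]
  exact isUnit_one

/-- The compositional inverse `(1 + 2x - e^x)^{-1}`. -/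
noncomputable def innerSeriesInv : PowerSeries ℚ :=
  PowerSeries.substInvOfIsUnit innerSeries isUnit_coeff_one_innerSeries

/-- The formal power series `-(1/2) log (2 - e^x) + (1/4) (e^{2x} - 1)`. -/
noncomputable def outerSeries : PowerSeries ℚ :=
  -PowerSeries.C (1 / 2 : ℚ) * PowerSeries.logOf (2 - PowerSeries.exp ℚ)
    + PowerSeries.C (1 / 4 : ℚ) * (PowerSeries.rescale (2 : ℚ) (PowerSeries.exp ℚ) - 1)

/-! Stable graphs with `n + 1` legs are produced from those with `n ≥ 1` legs by inserting the last
leg, either at a vertex or in the middle of an edge or leg. In genus 1 with all vertex genera 0 the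
graph is a single cycle with trees attached, so |Edge| = |Vert| = V and there are V + n edges and
legs. Isomorphism classes for `n + 1` correspond to vertices, and to edges or legs up to
automorphism, of representatives for `n`. Automorphisms fix all vertices. On flags, they can only
flip the loop if the cycle has length 1, or exchange the two parallel edges if it has length 2;
otherwise they are trivial. Thus the edges and legs form V + n classes, or V + n - 1 for a cycle of
length 2. Exactly one class lengthens a cycle of length 1 or 2 when subdivided: a loop becomes a
digon and a digon becomes rigid. This is the content of `Transversal.succ` and `HasKind.exists_loc`.

Weighting a graph by t^V turns this into recurrences for the polynomials l, d, a counting loop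
graphs, digon graphs and all graphs (`LegRecurrence`). With D = (1 - t x) ∂ₓ - t (1 + t) ∂ₜ, their
exponential generating series L, Δ, A satisfy D L = -t L + t, D Δ = -2 t Δ + t L and D A = -t Δ + t.
Such an equation determines its solution from the constant coefficient (`eq_of_legDeriv`), so closed
forms need only be verified.

The series T of rooted trees and F of forests satisfy D T = 1 and D F = F, hence ∂ₓF = F ∂ₓT (so F =
exp T) and (1 + t) T - t (F - 1) = x. Then L = t (F - 1), 2 Δ = L², and A = -½ log (1 - L) + L/2 +
L²/4, the last being used in differentiated form (`derivative_total`). At t = 1 the tree equation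
reads 1 + 2T - e^T = x, so T is the compositional inverse, and L = e^T - 1 turns A into the asserted
series. -/

/-! ### Power series over polynomials and the derivation `legDeriv`. -/

/-- The exponential generating series of a sequence of polynomials. -/
noncomputable def egf (a : ℕ → Polynomial ℚ) : PowerSeries (Polynomial ℚ) :=
  PowerSeries.mk fun n => Polynomial.C ((n.factorial : ℚ)⁻¹) * a n

/-- The coefficientwise derivative with respect to the parameter. -/
noncomputable def paramDeriv :
    PowerSeries (Polynomial ℚ) →+ PowerSeries (Polynomial ℚ) where
  toFun F := PowerSeries.mk fun n => Polynomial.derivative (PowerSeries.coeff n F)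
  map_zero' := by ext1 n; simp
  map_add' F G := by ext1 n; simp

theorem coeff_paramDeriv (F : PowerSeries (Polynomial ℚ)) (n : ℕ) :
    PowerSeries.coeff n (paramDeriv F) = Polynomial.derivative (PowerSeries.coeff n F) := by
  simp [paramDeriv]

/-- The parameter, as a constant power series. -/
noncomputable def param : PowerSeries (Polynomial ℚ) := PowerSeries.C Polynomial.X

theorem paramDeriv_mul (F G : PowerSeries (Polynomial ℚ)) :
    paramDeriv (F * G) = F * paramDeriv G + paramDeriv F * G := by
  ext1 n
  simp only [map_add, PowerSeries.coeff_mul, Polynomial.derivative_sum, coeff_paramDeriv,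
    Polynomial.derivative_mul, Finset.sum_add_distrib]
  exact add_comm _ _

/-- The derivation `∂ₓ - t (1 + t) ∂ₜ - t x ∂ₓ`. -/
noncomputable def legDeriv :
    PowerSeries (Polynomial ℚ) →+ PowerSeries (Polynomial ℚ) where
  toFun F := (1 - param * PowerSeries.X) * PowerSeries.derivative (Polynomial ℚ) F
      - param * (1 + param) * paramDeriv F
  map_zero' := by simp
  map_add' F G := by simp only [map_add]; ring

theorem legDeriv_apply (F : PowerSeries (Polynomial ℚ)) :
    legDeriv F = (1 - param * PowerSeries.X) * PowerSeries.derivative (Polynomial ℚ) F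
      - param * (1 + param) * paramDeriv F := rfl

theorem legDeriv_mul (F G : PowerSeries (Polynomial ℚ)) :
    legDeriv (F * G) = F * legDeriv G + legDeriv F * G := by
  simp only [legDeriv_apply, paramDeriv_mul, Derivation.leibniz, smul_eq_mul]
  ring

theorem legDeriv_one : legDeriv 1 = 0 := by
  have h := legDeriv_mul 1 1
  rw [one_mul, mul_one] at h
  simpa using h

theorem legDeriv_two : legDeriv 2 = 0 := by
  rw [← one_add_one_eq_two, map_add, legDeriv_one, add_zero]

theorem coeff_legDeriv (F : PowerSeries (Polynomial ℚ)) (n : ℕ) :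
    PowerSeries.coeff n (legDeriv F) =
      ((n : Polynomial ℚ) + 1) * PowerSeries.coeff (n + 1) F
        - Polynomial.X * (1 + Polynomial.X) * Polynomial.derivative (PowerSeries.coeff n F)
        - (n : Polynomial ℚ) * Polynomial.X * PowerSeries.coeff n F := by
  have h : param * (1 + param) =
      PowerSeries.C ((Polynomial.X : Polynomial ℚ) * (1 + Polynomial.X)) := by
    simp [param]
  rw [legDeriv_apply, h, sub_mul, one_mul, map_sub, map_sub, PowerSeries.coeff_derivative,
    PowerSeries.coeff_C_mul, coeff_paramDeriv, param, mul_assoc, PowerSeries.coeff_C_mul]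
  cases n with
  | zero => simp
  | succ n =>
    rw [PowerSeries.coeff_succ_X_mul, PowerSeries.coeff_derivative]
    push_cast
    ring

/-- `legDeriv` is designed for this identity: inserting a leg at one of V vertices contributes t ∂ₜ,
and on one of V + n edges and legs, with one more vertex, it contributes t² ∂ₜ + n t. -/
theorem legDeriv_egf (a : ℕ → Polynomial ℚ) :
    legDeriv (egf a) = egf fun n => a (n + 1)
      - Polynomial.X * (1 + Polynomial.X) * Polynomial.derivative (a n)
      - (n : Polynomial ℚ) * Polynomial.X * a n := by
  ext1 n
  rw [coeff_legDeriv]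
  simp only [egf, PowerSeries.coeff_mk, Polynomial.derivative_C_mul]
  have h : ((n : Polynomial ℚ) + 1) * Polynomial.C (((n + 1).factorial : ℚ)⁻¹)
      = Polynomial.C ((n.factorial : ℚ)⁻¹) := by
    have : ((n : Polynomial ℚ) + 1) = Polynomial.C ((n : ℚ) + 1) := by simp
    rw [this, ← Polynomial.C_mul]
    congr 1
    have := Nat.factorial_ne_zero n
    rw [Nat.factorial_succ]
    push_cast
    field_simp
  rw [← mul_assoc, h]
  ring

/-- The commutator with ∂ₓ comes only from the term -t x ∂ₓ of `legDeriv`. -/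
theorem legDeriv_derivative (F : PowerSeries (Polynomial ℚ)) :
    legDeriv (PowerSeries.derivative (Polynomial ℚ) F) =
      PowerSeries.derivative (Polynomial ℚ) (legDeriv F)
        + param * PowerSeries.derivative (Polynomial ℚ) F := by
  ext1 n
  rw [map_add, param, PowerSeries.coeff_C_mul]
  simp only [PowerSeries.coeff_derivative, coeff_legDeriv]
  have h : ((n : Polynomial ℚ) + 1) = Polynomial.C ((n : ℚ) + 1) := by simp
  rw [h, mul_comm (PowerSeries.coeff (n + 1) F), Polynomial.derivative_C_mul]
  simp only [map_add, map_natCast, map_one]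
  push_cast
  ring

theorem legDeriv_X : legDeriv PowerSeries.X = 1 - param * PowerSeries.X := by
  have : paramDeriv PowerSeries.X = 0 := by
    ext1 n
    rw [coeff_paramDeriv, PowerSeries.coeff_X]
    split_ifs <;> simp
  simp [legDeriv_apply, this]

theorem legDeriv_param : legDeriv param = - (param * (1 + param)) := by
  have : paramDeriv param = 1 := by
    ext1 n
    rw [coeff_paramDeriv, param, PowerSeries.coeff_C, PowerSeries.coeff_one]
    split_ifs <;> simp
  rw [legDeriv_apply, this, param, PowerSeries.derivative_C]
  ring

/-- Uniqueness of the solutions of linear equations for `legDeriv`. -/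
theorem eq_zero_of_legDeriv {c z : PowerSeries (Polynomial ℚ)} (h : legDeriv z = c * z)
    (h0 : PowerSeries.constantCoeff z = 0) : z = 0 := by
  have key : ∀ n, ∀ m ≤ n, PowerSeries.coeff m z = 0 := by
    intro n
    induction n with
    | zero =>
      intro m hm
      obtain rfl : m = 0 := by omega
      simpa using h0
    | succ n ih =>
      intro m hm
      rcases Nat.lt_or_ge m (n + 1) with h1 | h1
      · exact ih m (by omega)
      obtain rfl : m = n + 1 := by omega
      -- The coefficient of x^n in the equation expresses (n + 1) z_{n+1} through coefficients of
      -- index at most n, which vanish.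
      have h2 := congrArg (PowerSeries.coeff n) h
      rw [coeff_legDeriv, ih n le_rfl, PowerSeries.coeff_mul, Finset.sum_eq_zero] at h2
      · simp only [Polynomial.derivative_zero, mul_zero, sub_zero] at h2
        exact (mul_eq_zero.mp h2).resolve_left (by exact_mod_cast Nat.succ_ne_zero n)
      · intro p hp
        rw [ih p.2 (Finset.HasAntidiagonal.antidiagonal.snd_le hp), mul_zero]
  ext1 n
  simpa using key n n le_rfl

theorem eq_of_legDeriv {c b z w : PowerSeries (Polynomial ℚ)} (hz : legDeriv z = c * z + b)
    (hw : legDeriv w = c * w + b)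
    (h0 : PowerSeries.constantCoeff z = PowerSeries.constantCoeff w) : z = w := by
  rw [← sub_eq_zero]
  refine eq_zero_of_legDeriv (c := c) ?_ (by simp [h0])
  rw [map_sub, hz, hw]
  ring

/-! ### Series of trees and forests. -/

/-- The polynomials counting rooted trees with labelled leaves by inner vertices. -/
noncomputable def treePoly : ℕ → Polynomial ℚ
  | 0 => 0
  -- A tree with V inner vertices and n ≥ 1 leaves has V + n edges, those of the leaves and of the
  -- root included; a further leaf goes to a vertex or onto an edge. The last summand is the tree
  -- with a single leaf and no inner vertex.
  | n + 1 => Polynomial.X * (1 + Polynomial.X) * Polynomial.derivative (treePoly n)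
      + (n : Polynomial ℚ) * Polynomial.X * treePoly n + if n = 0 then 1 else 0

/-- The polynomials counting forests with labelled leaves by inner vertices. -/
noncomputable def forestPoly : ℕ → Polynomial ℚ
  | 0 => 1
  -- The additional summand `forestPoly n` accounts for the new leaf forming a tree by itself.
  | n + 1 => Polynomial.X * (1 + Polynomial.X) * Polynomial.derivative (forestPoly n)
      + (n : Polynomial ℚ) * Polynomial.X * forestPoly n + forestPoly n

theorem egf_ite_zero (p : Polynomial ℚ) :
    egf (fun n => if n = 0 then p else 0) = PowerSeries.C p := by
  ext1 n
  rw [egf, PowerSeries.coeff_mk, PowerSeries.coeff_C]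
  split_ifs with h <;> simp [h]

theorem constantCoeff_egf (a : ℕ → Polynomial ℚ) :
    PowerSeries.constantCoeff (egf a) = a 0 := by
  rw [← PowerSeries.coeff_zero_eq_constantCoeff_apply, egf, PowerSeries.coeff_mk]
  simp

theorem constantCoeff_derivative_egf (a : ℕ → Polynomial ℚ) :
    PowerSeries.constantCoeff (PowerSeries.derivative (Polynomial ℚ) (egf a)) = a 1 := by
  rw [← PowerSeries.coeff_zero_eq_constantCoeff_apply, PowerSeries.coeff_derivative, egf,
    PowerSeries.coeff_mk]
  simp

theorem egf_sub (a b : ℕ → Polynomial ℚ) : egf (fun n => a n - b n) = egf a - egf b := by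
  ext1 n
  simp [egf, mul_sub]

theorem egf_mul_left (p : Polynomial ℚ) (a : ℕ → Polynomial ℚ) :
    egf (fun n => p * a n) = PowerSeries.C p * egf a := by
  ext1 n
  rw [PowerSeries.coeff_C_mul]
  simp only [egf, PowerSeries.coeff_mk]
  ring

theorem legDeriv_tree : legDeriv (egf treePoly) = 1 := by
  rw [legDeriv_egf, ← map_one (PowerSeries.C (R := Polynomial ℚ)), ← egf_ite_zero]
  congr 1
  ext1 n
  rw [treePoly]
  ring

theorem legDeriv_forest : legDeriv (egf forestPoly) = egf forestPoly := by
  rw [legDeriv_egf]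
  congr 1
  ext1 n
  rw [forestPoly]
  ring

/-- This is F = exp T in differential form. By the commutator rule the difference z of the two sides
satisfies D z = (1 + t) z. -/
theorem derivative_forest :
    PowerSeries.derivative (Polynomial ℚ) (egf forestPoly) =
      egf forestPoly * PowerSeries.derivative (Polynomial ℚ) (egf treePoly) := by
  rw [← sub_eq_zero]
  refine eq_zero_of_legDeriv (c := 1 + param) ?_ ?_
  · rw [map_sub, legDeriv_mul, legDeriv_derivative, legDeriv_derivative, legDeriv_tree,
      legDeriv_forest, PowerSeries.derivative_one]
    ring
  · rw [map_sub, map_mul, constantCoeff_derivative_egf, constantCoeff_derivative_egf,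
      constantCoeff_egf]
    simp [forestPoly, treePoly]

/-- Combinatorially T = x + t (F - 1 - T): a tree is a leaf, or an inner vertex carrying a forest of
at least two trees. The proof verifies that both sides solve D z = -t z + 1. -/
theorem tree_equation :
    (1 + param) * egf treePoly - param * (egf forestPoly - 1) = PowerSeries.X := by
  refine eq_of_legDeriv (c := -param) (b := 1) ?_ (by rw [legDeriv_X]; ring) ?_
  · simp only [map_sub, map_add, legDeriv_mul, legDeriv_tree,
      legDeriv_forest, legDeriv_param, legDeriv_one]
    ring
  · simp [constantCoeff_egf, treePoly, forestPoly]

/-! ### The recurrences and their solution. -/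

/-- The recurrences satisfied by the numbers of graphs with a loop, with a double edge, and in
total. -/
structure LegRecurrence (l d a : ℕ → Polynomial ℚ) : Prop where
  loop_zero : l 0 = 0
  digon_zero : d 0 = 0
  total_zero : a 0 = 0
  loop_succ : ∀ n, l (n + 1) = Polynomial.X * (1 + Polynomial.X) * Polynomial.derivative (l n)
    + (n : Polynomial ℚ) * Polynomial.X * l n - Polynomial.X * l n
    + if n = 0 then Polynomial.X else 0
  -- One of the two subtracted copies of X d occurs because the parallel edges form a single class,
  -- the other because subdividing that class leaves the kind; loops enter through X l.
  digon_succ : ∀ n, d (n + 1) = Polynomial.X * (1 + Polynomial.X) * Polynomial.derivative (d n)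
    + (n : Polynomial ℚ) * Polynomial.X * d n - (2 * Polynomial.X) * d n + Polynomial.X * l n
  total_succ : ∀ n, a (n + 1) = Polynomial.X * (1 + Polynomial.X) * Polynomial.derivative (a n)
    + (n : Polynomial ℚ) * Polynomial.X * a n - Polynomial.X * d n
    + if n = 0 then Polynomial.X else 0

namespace LegRecurrence

variable {l d a : ℕ → Polynomial ℚ}

theorem legDeriv_loop (h : LegRecurrence l d a) :
    legDeriv (egf l) = -param * egf l + param := by
  rw [legDeriv_egf]
  have : (fun n => l (n + 1) - Polynomial.X * (1 + Polynomial.X) * Polynomial.derivative (l n)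
      - (n : Polynomial ℚ) * Polynomial.X * l n) = fun n => (if n = 0 then Polynomial.X else 0)
        - Polynomial.X * l n := by
    ext1 n
    rw [h.loop_succ]
    ring
  rw [this, egf_sub, egf_mul_left, egf_ite_zero, param]
  ring

theorem legDeriv_digon (h : LegRecurrence l d a) :
    legDeriv (egf d) = (-2 * param) * egf d + param * egf l := by
  rw [legDeriv_egf]
  have : (fun n => d (n + 1) - Polynomial.X * (1 + Polynomial.X) * Polynomial.derivative (d n)
      - (n : Polynomial ℚ) * Polynomial.X * d n) =
      fun n => Polynomial.X * l n - (2 * Polynomial.X) * d n := by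
    ext1 n
    rw [h.digon_succ]
    ring
  rw [this, egf_sub, egf_mul_left, egf_mul_left, map_mul, map_ofNat, param]
  ring

theorem legDeriv_total (h : LegRecurrence l d a) :
    legDeriv (egf a) = -param * egf d + param := by
  rw [legDeriv_egf]
  have : (fun n => a (n + 1) - Polynomial.X * (1 + Polynomial.X) * Polynomial.derivative (a n)
      - (n : Polynomial ℚ) * Polynomial.X * a n) = fun n => (if n = 0 then Polynomial.X else 0)
        - Polynomial.X * d n := by
    ext1 n
    rw [h.total_succ]
    ring
  rw [this, egf_sub, egf_mul_left, egf_ite_zero, param]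
  ring

/-- The vertex of the loop, of weight t, carries a nonempty forest. Both sides solve D z = -t z + t.
-/
theorem loop_eq (h : LegRecurrence l d a) : egf l = param * (egf forestPoly - 1) := by
  refine eq_of_legDeriv h.legDeriv_loop ?_ ?_
  · simp only [map_sub, legDeriv_mul,
      legDeriv_forest, legDeriv_param, legDeriv_one]
    ring
  · simp [constantCoeff_egf, h.loop_zero, forestPoly]

/-- A digon graph is an unordered pair of vertices, each carrying a nonempty forest as in `loop_eq`.
-/
theorem two_mul_digon_eq (h : LegRecurrence l d a) : 2 * egf d = egf l ^ 2 := by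
  refine eq_of_legDeriv (c := -2 * param) (b := 2 * param * egf l) ?_ ?_ ?_
  · rw [two_mul, map_add, h.legDeriv_digon]
    ring
  · rw [sq, legDeriv_mul, h.legDeriv_loop]
    ring
  · simp [constantCoeff_egf, h.loop_zero, h.digon_zero]

/-- The x-derivative of A = -½ log (1 - L) + L/2 + L²/4 with the denominator cleared, so that no
logarithm over polynomials occurs. The difference of the two sides is annihilated by D, since D L =
t (1 - L), D ∂ₓL = 0 and ∂ₓΔ = L ∂ₓL. -/
theorem derivative_total (h : LegRecurrence l d a) :
    2 * (1 - egf l) * PowerSeries.derivative (Polynomial ℚ) (egf a) =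
      (2 - egf l ^ 2) * PowerSeries.derivative (Polynomial ℚ) (egf l) := by
  have hd := congrArg (PowerSeries.derivative (Polynomial ℚ)) h.two_mul_digon_eq
  have hp : PowerSeries.derivative (Polynomial ℚ) param = 0 := by
    rw [param, PowerSeries.derivative_C]
  have h2' : PowerSeries.derivative (Polynomial ℚ) (2 : PowerSeries (Polynomial ℚ)) = 0 := by
    rw [← map_ofNat (PowerSeries.C (R := Polynomial ℚ)) 2, PowerSeries.derivative_C]
  rw [← sub_eq_zero]
  refine eq_zero_of_legDeriv (c := 0) ?_ ?_
  · simp only [sq, Derivation.leibniz, smul_eq_mul, h2', mul_zero, add_zero] at hd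
    simp only [map_sub, map_add, map_neg, sq, legDeriv_mul, Derivation.leibniz, smul_eq_mul,
      legDeriv_derivative, h.legDeriv_loop, h.legDeriv_total, legDeriv_one, legDeriv_two, hp]
    linear_combination (-param * (1 - egf l)) * hd
  · rw [map_sub, map_mul, map_mul, map_mul, constantCoeff_derivative_egf,
      constantCoeff_derivative_egf, h.loop_succ, h.total_succ, map_sub, map_sub, map_pow,
      constantCoeff_egf]
    simp [h.loop_zero, h.digon_zero, h.total_zero]

end LegRecurrence

/-! ### Specialization at t = 1 and comparison with the closed formula. -/

/-- Specialization of the parameter at `1`. -/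
noncomputable def specialize : PowerSeries (Polynomial ℚ) →+* PowerSeries ℚ :=
  PowerSeries.map (Polynomial.evalRingHom (1 : ℚ))

theorem specialize_param : specialize param = 1 := by
  simp [specialize, param]

theorem specialize_X : specialize PowerSeries.X = PowerSeries.X := by
  simp [specialize]

theorem specialize_derivative (F : PowerSeries (Polynomial ℚ)) :
    specialize (PowerSeries.derivative (Polynomial ℚ) F) =
      PowerSeries.derivative ℚ (specialize F) := by
  ext1 n
  simp [specialize, PowerSeries.coeff_derivative]

theorem constantCoeff_specialize_egf (a : ℕ → Polynomial ℚ) :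
    PowerSeries.constantCoeff (specialize (egf a)) = (a 0).eval 1 := by
  rw [← PowerSeries.coeff_zero_eq_constantCoeff_apply]
  simp [specialize, egf]

theorem PowerSeries.eq_zero_of_derivative_eq_mul {c z : PowerSeries ℚ}
    (h : PowerSeries.derivative ℚ z = z * c) (h0 : PowerSeries.constantCoeff z = 0) : z = 0 := by
  have key : ∀ n, ∀ m ≤ n, PowerSeries.coeff m z = 0 := by
    intro n
    induction n with
    | zero =>
      intro m hm
      obtain rfl : m = 0 := by omega
      simpa using h0
    | succ n ih =>
      intro m hm
      rcases Nat.lt_or_ge m (n + 1) with h1 | h1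
      · exact ih m (by omega)
      obtain rfl : m = n + 1 := by omega
      have h2 := congrArg (PowerSeries.coeff n) h
      rw [PowerSeries.coeff_derivative, PowerSeries.coeff_mul, Finset.sum_eq_zero] at h2
      · exact (mul_eq_zero.mp h2).resolve_right (by exact_mod_cast Nat.succ_ne_zero n)
      · intro p hp
        rw [ih p.1 (Finset.HasAntidiagonal.antidiagonal.fst_le hp), zero_mul]
  ext1 n
  simpa using key n n le_rfl

section Subst

variable {F : PowerSeries ℚ}

theorem PowerSeries.subst_one_of_hasSubst (hs : PowerSeries.HasSubst F) :
    PowerSeries.subst F (1 : PowerSeries ℚ) = 1 := by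
  rw [← PowerSeries.coe_substAlgHom hs, map_one]

theorem PowerSeries.subst_C_mul (hs : PowerSeries.HasSubst F) (r : ℚ) (f : PowerSeries ℚ) :
    PowerSeries.subst F (PowerSeries.C r * f) = PowerSeries.C r * PowerSeries.subst F f := by
  rw [PowerSeries.subst_mul hs, PowerSeries.subst_C]
  rfl

theorem PowerSeries.constantCoeff_subst_of_constantCoeff
    (hF : PowerSeries.constantCoeff F = 0) (f : PowerSeries ℚ) :
    PowerSeries.constantCoeff (PowerSeries.subst F f : PowerSeries ℚ) =
      PowerSeries.constantCoeff f := by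
  have hs : PowerSeries.HasSubst F := PowerSeries.HasSubst.of_constantCoeff_zero' hF
  have h : (PowerSeries.subst F (f - PowerSeries.C (PowerSeries.constantCoeff f)) :
      PowerSeries ℚ).constantCoeff = 0 :=
    PowerSeries.constantCoeff_subst_eq_zero hF _ (by simp)
  rw [PowerSeries.subst_sub hs, PowerSeries.subst_C] at h
  have h2 : PowerSeries.constantCoeff (MvPowerSeries.C (PowerSeries.constantCoeff f) :
      PowerSeries ℚ) = PowerSeries.constantCoeff f := PowerSeries.constantCoeff_C _
  rw [map_sub, sub_eq_zero] at h
  exact h.trans h2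

end Subst

/-- `egf forestPoly` specializes to the exponential of `egf treePoly`. -/
theorem specialize_forest :
    specialize (egf forestPoly) =
      PowerSeries.subst (specialize (egf treePoly)) (PowerSeries.exp ℚ) := by
  have hF : PowerSeries.constantCoeff (specialize (egf treePoly)) = 0 := by
    simp [constantCoeff_specialize_egf, treePoly]
  have hs := PowerSeries.HasSubst.of_constantCoeff_zero' hF
  rw [← sub_eq_zero]
  -- Both series solve z' = z T' with constant coefficient 1.
  refine PowerSeries.eq_zero_of_derivative_eq_mul
    (c := PowerSeries.derivative ℚ (specialize (egf treePoly))) ?_ ?_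
  · rw [map_sub, PowerSeries.derivative_subst hs, PowerSeries.derivative_exp,
      ← specialize_derivative, derivative_forest, map_mul, specialize_derivative]
    exact (sub_mul _ _ _).symm
  · rw [map_sub, constantCoeff_specialize_egf]
    erw [PowerSeries.constantCoeff_subst_of_constantCoeff hF]
    simp [forestPoly]

/-- `egf treePoly` specializes to the compositional inverse of `1 + 2x - e^x`. -/
theorem specialize_tree : specialize (egf treePoly) = innerSeriesInv := by
  have hF : PowerSeries.constantCoeff (specialize (egf treePoly)) = 0 := by
    simp [constantCoeff_specialize_egf, treePoly]
  have hs := PowerSeries.HasSubst.of_constantCoeff_zero' hF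
  have hX : PowerSeries.subst (specialize (egf treePoly)) innerSeries = PowerSeries.X := by
    have h := congrArg specialize tree_equation
    rw [map_sub, map_mul, map_mul, map_add, map_sub, specialize_param, map_one, specialize_X,
      specialize_forest] at h
    have h2 : (2 : PowerSeries ℚ) = PowerSeries.C (2 : ℚ) := (map_ofNat PowerSeries.C 2).symm
    rw [innerSeries, PowerSeries.subst_sub hs, PowerSeries.subst_add hs,
      PowerSeries.subst_one_of_hasSubst hs, h2, PowerSeries.subst_C_mul hs, PowerSeries.subst_X hs,
      ← h2, ← h]
    ring
  have hi : PowerSeries.HasSubst innerSeries :=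
    PowerSeries.HasSubst.of_constantCoeff_zero' constantCoeff_innerSeries
  -- By associativity of substitution, the left inverse `innerSeriesInv` of `innerSeries` agrees
  -- with the right inverse T from `hX`.
  have h := PowerSeries.subst_comp_subst_apply hi hs innerSeriesInv
  rw [hX, innerSeriesInv, PowerSeries.subst_substInvOfIsUnit_left _ constantCoeff_innerSeries,
    PowerSeries.subst_X hs, ← PowerSeries.map_algebraMap_eq_subst_X] at h
  rw [h]
  simp [innerSeriesInv]

theorem derivative_logOf_mul {g : PowerSeries ℚ} (hg : PowerSeries.constantCoeff g = 1) :
    g * PowerSeries.derivative ℚ (PowerSeries.logOf g) = PowerSeries.derivative ℚ g := by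
  have hs : PowerSeries.HasSubst (g - 1) :=
    PowerSeries.HasSubst.of_constantCoeff_zero' (by simp [hg])
  have h : (1 + PowerSeries.X) * PowerSeries.derivative ℚ (PowerSeries.log ℚ) = 1 := by
    ext1 n
    rw [PowerSeries.deriv_log, add_mul, one_mul, map_add]
    cases n with
    | zero => simp
    | succ n => simp [PowerSeries.coeff_succ_X_mul, PowerSeries.coeff_one, pow_succ]
  have h2 := congrArg (PowerSeries.subst (g - 1)) h
  rw [PowerSeries.subst_mul hs, PowerSeries.subst_add hs, PowerSeries.subst_X hs,
    PowerSeries.subst_one_of_hasSubst hs, add_sub_cancel] at h2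
  rw [PowerSeries.logOf_eq, PowerSeries.derivative_subst hs, ← mul_assoc]
  erw [h2]
  simp

/-- The equation of `derivative_total` with L = e^x - 1, since 2 - (e^x - 1)² = 1 + 2 e^x - e^{2x}.
-/
theorem derivative_outerSeries :
    2 * (2 - PowerSeries.exp ℚ) * PowerSeries.derivative ℚ outerSeries =
      (1 + 2 * PowerSeries.exp ℚ - PowerSeries.exp ℚ ^ 2) * PowerSeries.exp ℚ := by
  have h2 : (2 : PowerSeries ℚ) = PowerSeries.C (2 : ℚ) := (map_ofNat PowerSeries.C 2).symm
  have hlog := derivative_logOf_mul (g := 2 - PowerSeries.exp ℚ) (by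
    rw [h2]; simp; norm_num)
  have hexp := PowerSeries.exp_pow_eq_rescale_exp (A := ℚ) 2
  rw [map_sub, PowerSeries.derivative_exp, h2, PowerSeries.derivative_C, ← h2] at hlog
  have hh : (2 : PowerSeries ℚ) * PowerSeries.C (1 / 2 : ℚ) = 1 := by
    rw [h2, ← map_mul]; norm_num
  have hq : (4 : PowerSeries ℚ) * PowerSeries.C (1 / 4 : ℚ) = 1 := by
    have h4 : (4 : PowerSeries ℚ) = PowerSeries.C (4 : ℚ) := (map_ofNat PowerSeries.C 4).symm
    rw [h4, ← map_mul]; norm_num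
  have hc : ∀ r : ℚ, PowerSeries.derivative ℚ (PowerSeries.C r) = 0 :=
    fun _ => PowerSeries.derivative_C
  rw [outerSeries]
  norm_num at hexp
  rw [← hexp]
  simp only [map_add, map_neg, map_sub, neg_mul, sq, Derivation.leibniz, smul_eq_mul, hc,
    PowerSeries.derivative_one, PowerSeries.derivative_exp]
  linear_combination (-2 * PowerSeries.C (1 / 2 : ℚ)) * hlog + PowerSeries.exp ℚ * hh
    + (2 - PowerSeries.exp ℚ) * PowerSeries.exp ℚ ^ 2 * hq

theorem LegRecurrence.specialize_total {l d a : ℕ → Polynomial ℚ} (h : LegRecurrence l d a) :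
    specialize (egf a) = PowerSeries.subst innerSeriesInv outerSeries := by
  have hF : PowerSeries.constantCoeff innerSeriesInv = 0 := by
    rw [← specialize_tree]
    simp [constantCoeff_specialize_egf, treePoly]
  have hs := PowerSeries.HasSubst.of_constantCoeff_zero' hF
  have hl : specialize (egf l) =
      PowerSeries.subst innerSeriesInv (PowerSeries.exp ℚ) - 1 := by
    rw [h.loop_eq, map_mul, map_sub, specialize_param, specialize_forest, specialize_tree, map_one,
      one_mul]
  have hl' : PowerSeries.derivative ℚ (specialize (egf l)) =
      PowerSeries.subst innerSeriesInv (PowerSeries.exp ℚ)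
        * PowerSeries.derivative ℚ innerSeriesInv := by
    rw [hl, map_sub, PowerSeries.derivative_subst hs, PowerSeries.derivative_exp,
      PowerSeries.derivative_one, sub_zero]
  have ha := congrArg specialize h.derivative_total
  simp only [map_mul, map_sub, map_pow, map_one, map_ofNat, specialize_derivative] at ha
  rw [hl', hl] at ha
  have h2 : (2 : PowerSeries ℚ) = PowerSeries.C (2 : ℚ) := (map_ofNat PowerSeries.C 2).symm
  have ho := congrArg (PowerSeries.subst innerSeriesInv) derivative_outerSeries
  have hs2 : PowerSeries.subst innerSeriesInv (2 : PowerSeries ℚ) = (2 : PowerSeries ℚ) := by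
    rw [h2, PowerSeries.subst_C]; rfl
  rw [PowerSeries.subst_mul hs, PowerSeries.subst_mul hs, PowerSeries.subst_mul hs,
    PowerSeries.subst_sub hs, PowerSeries.subst_sub hs, PowerSeries.subst_add hs,
    PowerSeries.subst_mul hs, PowerSeries.subst_pow hs, PowerSeries.subst_one_of_hasSubst hs,
    hs2] at ho
  -- It suffices to compare derivatives and constant coefficients; the factor 2 (2 - E) can be
  -- cancelled because its constant coefficient is 2.
  refine PowerSeries.derivative.ext ?_ ?_
  · rw [PowerSeries.derivative_subst hs]
    set E : PowerSeries ℚ := PowerSeries.subst innerSeriesInv (PowerSeries.exp ℚ) with hE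
    have hne : 2 * (2 - E) ≠ 0 := by
      intro h0
      have := congrArg PowerSeries.constantCoeff h0
      rw [map_mul, map_sub, hE, PowerSeries.constantCoeff_subst_of_constantCoeff hF, h2] at this
      norm_num at this
    refine mul_left_cancel₀ hne ?_
    linear_combination ha - PowerSeries.derivative ℚ innerSeriesInv * ho
  · rw [constantCoeff_specialize_egf, h.total_zero,
      PowerSeries.constantCoeff_subst_of_constantCoeff hF, outerSeries]
    have h0 := PowerSeries.constantCoeff_logOf (f := 2 - PowerSeries.exp ℚ) (by
      rw [h2]; simp; norm_num)
    have h1 : PowerSeries.constantCoeff (PowerSeries.rescale (2 : ℚ) (PowerSeries.exp ℚ)) = 1 := by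
      rw [← PowerSeries.coeff_zero_eq_constantCoeff_apply, PowerSeries.coeff_rescale]
      simp
    simp [h0, h1]
-- Operations on graphs: attaching, subdividing and smoothing.
theorem Equiv.exists_of_apply_none {α β : Type*} (e : Option α ≃ Option β) (h : e none = none) :
    ∃ f : α ≃ β, ∀ a, e (some a) = some (f a) := by
  refine ⟨e.removeNone, fun a => (Equiv.removeNone_some e ?_).symm⟩
  have : e (some a) ≠ none := fun h' => by simpa using e.injective (h'.trans h.symm)
  obtain ⟨b, hb⟩ := Option.ne_none_iff_exists.mp this
  exact ⟨b, hb.symm⟩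

theorem Equiv.exists_of_apply_inl {α α' β β' : Type*} (e : α ⊕ β ≃ α' ⊕ β')
    (hl : ∀ a, ∃ a', e (Sum.inl a) = Sum.inl a') (hr : ∀ b, ∃ b', e (Sum.inr b) = Sum.inr b') :
    ∃ f : α ≃ α', ∀ a, e (Sum.inl a) = Sum.inl (f a) := by
  choose f hf using hl
  refine ⟨Equiv.ofBijective f ⟨fun x y hxy => ?_, fun y => ?_⟩, hf⟩
  · have : e (Sum.inl x) = e (Sum.inl y) := by rw [hf, hf, hxy]
    simpa using e.injective this
  · rcases hx : e.symm (Sum.inl y) with x | b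
    · refine ⟨x, ?_⟩
      have := hf x
      rw [← hx, Equiv.apply_symm_apply] at this
      simpa using this.symm
    · obtain ⟨b', hb'⟩ := hr b
      rw [← hx, Equiv.apply_symm_apply] at hb'
      simp at hb'

namespace LabelledGraph

variable {n : ℕ}

/-- The numbering of the fixed points given by a bijective family of fixed points. -/
noncomputable def legEquiv {F : Type} {inv : F → F} (leg : Fin n → F)
    (fix : ∀ i, inv (leg i) = leg i) (inj : Function.Injective leg)
    (surj : ∀ h, inv h = h → ∃ i, leg i = h) : Fin n ≃ {h : F // inv h = h} :=
  Equiv.ofBijective (fun i => ⟨leg i, fix i⟩)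
    ⟨fun _ _ h => inj (congrArg Subtype.val h), fun h => by
      obtain ⟨i, hi⟩ := surj h.1 h.2
      exact ⟨i, Subtype.ext hi⟩⟩

theorem inv_leg (G : LabelledGraph n) (i : Fin n) : G.inv (G.leg i) = G.leg i := (G.leg i).2

theorem leg_injective (G : LabelledGraph n) : Function.Injective fun i => (G.leg i : G.Flag) :=
  Subtype.val_injective.comp G.leg.injective

theorem exists_leg (G : LabelledGraph n) {h : G.Flag} (hh : G.inv h = h) :
    ∃ i, (G.leg i : G.Flag) = h :=
  ⟨G.leg.symm ⟨h, hh⟩, by simp⟩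

theorem inv_eq_iff (G : LabelledGraph n) {x y : G.Flag} : G.inv x = y ↔ x = G.inv y :=
  ⟨fun h => by rw [← h, G.inv_inv], fun h => by rw [h, G.inv_inv]⟩

theorem inv_injective (G : LabelledGraph n) : Function.Injective G.inv :=
  fun x y h => by rw [G.inv_eq_iff.mp h, G.inv_inv]

/-! ### Attaching a leg to a vertex -/

/-- The flags of `attach G v` corresponding to the legs. -/
def attachLeg (G : LabelledGraph n) : Fin (n + 1) → Option G.Flag :=
  Fin.lastCases none fun i => some (G.leg i)

@[simp]
theorem attachLeg_last (G : LabelledGraph n) : G.attachLeg (Fin.last n) = none := by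
  simp [attachLeg]

@[simp]
theorem attachLeg_castSucc (G : LabelledGraph n) (i : Fin n) :
    G.attachLeg i.castSucc = some (G.leg i : G.Flag) := by
  simp [attachLeg]

/-- The graph with an additional leg at a vertex. -/
noncomputable def attach (G : LabelledGraph n) (v : G.Vert) : LabelledGraph (n + 1) where
  Vert := G.Vert
  Flag := Option G.Flag
  root x := x.elim v G.root
  inv := Option.map G.inv
  inv_inv h := by cases h <;> simp [G.inv_inv]
  leg := legEquiv G.attachLeg
    (fun i => by induction i using Fin.lastCases <;> simp [G.inv_leg])
    (fun i j => by
      induction i using Fin.lastCases <;> induction j using Fin.lastCases <;>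
        simp [Subtype.val_inj])
    (fun h hh => by
      cases h with
      | none => exact ⟨Fin.last n, by simp⟩
      | some h =>
        obtain ⟨i, hi⟩ := G.exists_leg (by simpa using hh : G.inv h = h)
        exact ⟨i.castSucc, by simp [hi]⟩)
  vgenus := G.vgenus
  nonempty := G.nonempty
  connected v w := Relation.ReflTransGen.mono
    (fun _ _ ⟨h, h1, h2⟩ => ⟨some h, h1, h2⟩) _ _ (G.connected v w)

section Attach

variable {G H : LabelledGraph n} {v : G.Vert} {w : H.Vert}

/-- Attaching a leg is functorial. -/
noncomputable def Iso.attach (φ : Iso G H) (hv : φ.vert v = w) :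
    Iso (G.attach v) (H.attach w) where
  vert := φ.vert
  flag := φ.flag.optionCongr
  root_flag h := by
    cases h with
    | none => exact hv.symm
    | some h => exact φ.root_flag h
  inv_flag h := by
    cases h with
    | none => rfl
    | some h => exact congrArg some (φ.inv_flag h)
  leg_flag i := by
    change Option.map φ.flag (G.attachLeg i) = H.attachLeg i
    induction i using Fin.lastCases <;> simp [φ.leg_flag]
  vgenus_vert := φ.vgenus_vert

/-- Isomorphisms between graphs with attached legs come from isomorphisms. -/
theorem Iso.exists_of_attach (ψ : Iso (G.attach v) (H.attach w)) :
    ∃ φ : Iso G H, φ.vert v = w ∧ (∀ h, ψ.flag (some h) = some (φ.flag h)) ∧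
      ∀ u, ψ.vert u = φ.vert u := by
  obtain ⟨e, he⟩ : ∃ e : Option G.Flag ≃ Option H.Flag, e = ψ.flag := ⟨_, rfl⟩
  have hroot : ∀ x, (e x).elim w H.root = ψ.vert (x.elim v G.root) := he ▸ ψ.root_flag
  have hinv : ∀ x, (e x).map H.inv = e (x.map G.inv) := he ▸ ψ.inv_flag
  have hleg : ∀ i, e (G.attachLeg i) = H.attachLeg i := he ▸ ψ.leg_flag
  -- The attached flag is the last leg on both sides, so the numbering forces it to be preserved.
  have h0 : e none = none := by simpa using hleg (Fin.last n)
  obtain ⟨f, hf⟩ := Equiv.exists_of_apply_none e h0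
  refine ⟨⟨ψ.vert, f, fun h => ?_, fun h => ?_, fun i => ?_, ψ.vgenus_vert⟩, ?_,
    fun h => (congrArg (fun e => e (some h)) he).symm.trans (hf h), fun _ => rfl⟩
  · have := hroot (some h)
    rw [hf] at this
    exact this
  · simpa [hf] using hinv (some h)
  · simpa [hf] using hleg i.castSucc
  · have := hroot none
    rw [h0] at this
    exact this.symm

end Attach

/-- The graph without its last leg. -/
noncomputable def detach (G : LabelledGraph (n + 1)) : LabelledGraph n where
  Vert := G.Vert
  Flag := {x : G.Flag // x ≠ G.leg (Fin.last n)}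
  fintypeFlag := Fintype.ofFinite _
  root x := G.root x
  inv x := ⟨G.inv x, fun h => x.2 (by rw [G.inv_eq_iff.mp h, G.inv_leg])⟩
  inv_inv x := Subtype.ext (G.inv_inv x)
  leg := legEquiv
    (fun i => ⟨G.leg i.castSucc, fun h => by
      have := G.leg_injective h
      exact (Fin.castSucc_lt_last i).ne this⟩)
    (fun i => Subtype.ext (G.inv_leg _))
    (fun i j h => by
      have := G.leg_injective (a₁ := i.castSucc) (a₂ := j.castSucc)
        (congrArg (fun x : {x : G.Flag // x ≠ G.leg (Fin.last n)} => (x : G.Flag)) h)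
      simpa using this)
    (fun h hh => by
      obtain ⟨i, hi⟩ := G.exists_leg (congrArg Subtype.val hh)
      induction i using Fin.lastCases with
      | last => exact absurd hi.symm h.2
      | cast i => exact ⟨i, Subtype.ext hi⟩)
  vgenus := G.vgenus
  nonempty := G.nonempty
  connected v w := by
    refine Relation.ReflTransGen.lift' id ?_ _ _ (G.connected v w)
    rintro a b ⟨h, h1, h2⟩
    by_cases hh : h = G.leg (Fin.last n)
    · rw [hh, G.inv_leg, ← hh, h1] at h2
      subst h2
      exact Relation.ReflTransGen.refl
    · exact Relation.ReflTransGen.single ⟨⟨h, hh⟩, h1, h2⟩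

open Classical in
/-- Attaching the last leg again. -/
noncomputable def attachDetach (G : LabelledGraph (n + 1)) :
    Iso (G.detach.attach (G.root (G.leg (Fin.last n)))) G where
  vert := Equiv.refl _
  flag := Equiv.optionSubtypeNe (G.leg (Fin.last n) : G.Flag)
  root_flag h := by
    cases h <;> rfl
  inv_flag h := by
    cases h with
    | none => exact G.inv_leg _
    | some h => rfl
  leg_flag i := by
    change Equiv.optionSubtypeNe (G.leg (Fin.last n) : G.Flag) (G.detach.attachLeg i) = G.leg i
    induction i using Fin.lastCases with
    | last => rw [attachLeg_last]; rfl
    | cast i => rw [attachLeg_castSucc]; rfl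
  vgenus_vert _ := rfl

/-! ### Subdividing an edge or a leg -/

open Classical in
/-- The involution of the graph in which an edge or leg is subdivided. -/
noncomputable def subdivInv (G : LabelledGraph n) (h : G.Flag) : G.Flag ⊕ Bool → G.Flag ⊕ Bool
  | Sum.inl x => if x = h then Sum.inr true else
      if x = G.inv h then Sum.inr false else Sum.inl (G.inv x)
  | Sum.inr true => Sum.inl h
  -- If `h` is a leg, the flag `false` takes over its role as a leg; otherwise it is joined to the
  -- other half of the edge.
  | Sum.inr false => if G.inv h = h then Sum.inr false else Sum.inl (G.inv h)

section SubdivInv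

variable (G : LabelledGraph n) (h : G.Flag)

theorem subdivInv_self : G.subdivInv h (Sum.inl h) = Sum.inr true := by simp [subdivInv]

theorem subdivInv_true : G.subdivInv h (Sum.inr true) = Sum.inl h := rfl

variable {h}

theorem subdivInv_inv (hh : G.inv h ≠ h) :
    G.subdivInv h (Sum.inl (G.inv h)) = Sum.inr false := by simp [subdivInv, hh]

theorem subdivInv_inl {x : G.Flag} (h1 : x ≠ h) (h2 : x ≠ G.inv h) :
    G.subdivInv h (Sum.inl x) = Sum.inl (G.inv x) := by simp [subdivInv, h1, h2]

theorem subdivInv_false (hh : G.inv h ≠ h) :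
    G.subdivInv h (Sum.inr false) = Sum.inl (G.inv h) := by simp [subdivInv, hh]

theorem subdivInv_false_of_eq (hh : G.inv h = h) :
    G.subdivInv h (Sum.inr false) = Sum.inr false := by simp [subdivInv, hh]

variable (h)

theorem subdivInv_subdivInv (x : G.Flag ⊕ Bool) : G.subdivInv h (G.subdivInv h x) = x := by
  rcases x with x | _ | _
  · by_cases h1 : x = h
    · rw [h1, subdivInv_self, subdivInv_true]
    by_cases h2 : x = G.inv h
    · have h3 : G.inv h ≠ h := fun h3 => h1 (h2.trans h3)
      rw [h2, subdivInv_inv _ h3, subdivInv_false _ h3]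
    · rw [subdivInv_inl _ h1 h2, subdivInv_inl, G.inv_inv]
      · exact fun h3 => h2 (G.inv_eq_iff.mp h3)
      · exact fun h3 => h1 (G.inv_injective h3)
  · by_cases h1 : G.inv h = h
    · rw [subdivInv_false_of_eq _ h1, subdivInv_false_of_eq _ h1]
    · rw [subdivInv_false _ h1, subdivInv_inv _ h1]
  · rw [subdivInv_true, subdivInv_self]

theorem subdivInv_inl_eq_inl_iff {x y : G.Flag} :
    G.subdivInv h (Sum.inl x) = Sum.inl y ↔ x ≠ h ∧ x ≠ G.inv h ∧ G.inv x = y := by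
  by_cases h1 : x = h
  · simp [h1, subdivInv_self]
  by_cases h2 : x = G.inv h
  · have h3 : G.inv h ≠ h := fun h3 => h1 (h2.trans h3)
    simp [h2, subdivInv_inv _ h3]
  · simp [subdivInv_inl _ h1 h2, h1, h2]

end SubdivInv

open Classical in
/-- The flags of `subdiv G h` corresponding to the legs. -/
noncomputable def subdivLeg (G : LabelledGraph n) (h : G.Flag) (i : Fin n) : G.Flag ⊕ Bool :=
  if (G.leg i : G.Flag) = h then Sum.inr false else Sum.inl (G.leg i)

/-- The graph in which the edge or leg of a flag `h` is subdivided by a new vertex. -/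
noncomputable def subdiv (G : LabelledGraph n) (h : G.Flag) : LabelledGraph n where
  Vert := Option G.Vert
  Flag := G.Flag ⊕ Bool
  root := Sum.elim (fun x => some (G.root x)) fun _ => none
  inv := G.subdivInv h
  inv_inv := G.subdivInv_subdivInv h
  leg := legEquiv (G.subdivLeg h)
    (fun i => by
      unfold subdivLeg
      split_ifs with hi
      · rw [subdivInv_false_of_eq]
        rw [← hi, G.inv_leg]
      · rw [subdivInv_inl _ hi, G.inv_leg]
        intro h2
        rw [← G.inv_eq_iff, G.inv_leg] at h2
        exact hi h2)
    (fun i j hij => by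
      unfold subdivLeg at hij
      split_ifs at hij with hi hj hj
      · exact G.leg_injective (hi.trans hj.symm)
      · exact G.leg_injective (Sum.inl_injective hij))
    (fun x hx => by
      rcases x with x | _ | _
      · obtain ⟨h1, -, h3⟩ := (G.subdivInv_inl_eq_inl_iff h).mp hx
        obtain ⟨i, rfl⟩ := G.exists_leg h3
        exact ⟨i, if_neg h1⟩
      · by_cases hh : G.inv h = h
        · obtain ⟨i, hi⟩ := G.exists_leg hh
          exact ⟨i, if_pos hi⟩
        · rw [subdivInv_false _ hh] at hx
          simp at hx
      · simp [subdivInv_true] at hx)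
  vgenus v := v.elim 0 G.vgenus
  nonempty := ⟨none⟩
  connected := by
    set r : Option G.Vert → Option G.Vert → Prop := fun a b => ∃ x : G.Flag ⊕ Bool,
      Sum.elim (fun x => some (G.root x)) (fun _ => none) x = a ∧
        Sum.elim (fun x => some (G.root x)) (fun _ => none) (G.subdivInv h x) = b with hr
    have h1 : r (some (G.root h)) none :=
      ⟨Sum.inl h, rfl, by rw [subdivInv_self]; rfl⟩
    have h2 : r none (some (G.root h)) :=
      ⟨Sum.inr true, rfl, by rw [subdivInv_true]; rfl⟩
    -- A step along the subdivided edge is replaced by two steps through the new vertex.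
    have key : ∀ v w, Relation.ReflTransGen r (some v) (some w) := by
      intro v w
      refine Relation.ReflTransGen.lift' some ?_ _ _ (G.connected v w)
      rintro a b ⟨x, rfl, rfl⟩
      by_cases hh : G.inv h = h
      · by_cases hx : x = h
        · rw [hx, hh]
        · exact Relation.ReflTransGen.single
            ⟨Sum.inl x, rfl, by rw [subdivInv_inl _ hx (by rwa [hh])]; rfl⟩
      · have h3 : r none (some (G.root (G.inv h))) :=
          ⟨Sum.inr false, rfl, by rw [subdivInv_false _ hh]; rfl⟩
        have h4 : r (some (G.root (G.inv h))) none :=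
          ⟨Sum.inl (G.inv h), rfl, by rw [subdivInv_inv _ hh]; rfl⟩
        by_cases hx : x = h
        · rw [hx]
          exact (Relation.ReflTransGen.single h1).tail h3
        by_cases hx' : x = G.inv h
        · rw [hx', G.inv_inv]
          exact (Relation.ReflTransGen.single h4).tail h2
        exact Relation.ReflTransGen.single
          ⟨Sum.inl x, rfl, by rw [subdivInv_inl _ hx hx']; rfl⟩
    rintro (_ | v) (_ | w)
    · exact Relation.ReflTransGen.refl
    · exact (Relation.ReflTransGen.single h2).trans (key _ _)
    · exact (key _ _).tail h1
    · exact key v w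

section Subdiv

variable {G H : LabelledGraph n} {h : G.Flag} {k : H.Flag}

/-- Subdividing is functorial. -/
noncomputable def Iso.subdiv (φ : Iso G H) (hk : φ.flag h = k) :
    Iso (G.subdiv h) (H.subdiv k) where
  vert := φ.vert.optionCongr
  flag := Equiv.sumCongr φ.flag (Equiv.refl _)
  root_flag x := by
    rcases x with x | b
    · exact congrArg some (φ.root_flag x)
    · rfl
  inv_flag x := by
    change H.subdivInv k (Sum.map φ.flag id x) = Sum.map φ.flag id (G.subdivInv h x)
    subst hk
    have e := φ.inv_flag h
    rcases x with x | _ | _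
    · by_cases h1 : x = h
      · subst h1
        simp [subdivInv_self]
      by_cases h2 : x = G.inv h
      · subst h2
        have h3 : H.inv (φ.flag h) ≠ φ.flag h := by rw [e]; simpa using h1
        simp [subdivInv_inv _ h1, ← e, subdivInv_inv _ h3]
      · have h3 : φ.flag x ≠ H.inv (φ.flag h) := by rw [e]; simpa using h2
        have h4 : φ.flag x ≠ φ.flag h := by simpa using h1
        simp [subdivInv_inl _ h1 h2, subdivInv_inl _ h4 h3, φ.inv_flag]
    · by_cases h1 : G.inv h = h
      · have h2 : H.inv (φ.flag h) = φ.flag h := by rw [e, h1]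
        simp [subdivInv_false_of_eq _ h1, subdivInv_false_of_eq _ h2]
      · have h2 : H.inv (φ.flag h) ≠ φ.flag h := by rw [e]; simpa using h1
        simp [subdivInv_false _ h1, subdivInv_false _ h2, e]
    · simp [subdivInv_true]
  leg_flag i := by
    change Sum.map φ.flag id (G.subdivLeg h i) = H.subdivLeg k i
    subst hk
    rw [subdivLeg, subdivLeg, ← φ.leg_flag]
    by_cases h1 : (G.leg i : G.Flag) = h <;> simp [h1]
  vgenus_vert v := by
    rcases v with _ | v
    · rfl
    · exact φ.vgenus_vert v

/-- Subdividing at the other flag of an edge. -/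
theorem exists_iso_subdiv_inv (G : LabelledGraph n) (h : G.Flag) :
    ∃ ψ : Iso (G.subdiv h) (G.subdiv (G.inv h)), ψ.vert none = none := by
  by_cases hh : G.inv h = h
  · rw [hh]
    exact ⟨Iso.refl _, rfl⟩
  have hh' : G.inv (G.inv h) ≠ G.inv h := by rw [G.inv_inv]; exact Ne.symm hh
  refine ⟨⟨Equiv.refl _, Equiv.sumCongr (Equiv.refl _) Equiv.boolNot, fun x => ?_, fun x => ?_,
    fun i => ?_, fun _ => rfl⟩, rfl⟩
  · rcases x with x | x <;> rfl
  · change G.subdivInv (G.inv h) (Sum.map id Bool.not x) = Sum.map id Bool.not (G.subdivInv h x)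
    rcases x with x | _ | _
    · by_cases h1 : x = h
      · subst h1
        have := subdivInv_inv _ hh'
        rw [G.inv_inv] at this
        simp [subdivInv_self, this]
      by_cases h2 : x = G.inv h
      · subst h2
        simp [subdivInv_inv _ hh, subdivInv_self]
      · have h3 : x ≠ G.inv (G.inv h) := by rwa [G.inv_inv]
        simp [subdivInv_inl _ h1 h2, subdivInv_inl _ h2 h3]
    · simp [subdivInv_false _ hh, subdivInv_true]
    · simp [subdivInv_true, subdivInv_false _ hh', G.inv_inv]
  · have h1 : (G.leg i : G.Flag) ≠ h := fun h1 => hh (by rw [← h1, G.inv_leg])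
    have h2 : (G.leg i : G.Flag) ≠ G.inv h := fun h2 => hh' (by rw [← h2, G.inv_leg])
    change Sum.map id Bool.not (G.subdivLeg h i) = G.subdivLeg (G.inv h) i
    rw [subdivLeg, subdivLeg, if_neg h1, if_neg h2]
    rfl

theorem Iso.exists_subdiv (φ : Iso G H) (hk : φ.flag h = k ∨ φ.flag h = H.inv k) :
    ∃ ψ : Iso (G.subdiv h) (H.subdiv k), ψ.vert none = none := by
  rcases hk with hk | hk
  · exact ⟨φ.subdiv hk, rfl⟩
  · have := exists_iso_subdiv_inv H (H.inv k)
    rw [H.inv_inv] at this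
    obtain ⟨ψ, hψ⟩ := this
    exact ⟨(φ.subdiv hk).trans ψ, hψ⟩

/-- Isomorphisms between subdivided graphs come from isomorphisms. -/
theorem Iso.exists_of_subdiv (ψ : Iso (G.subdiv h) (H.subdiv k)) (hψ : ψ.vert none = none) :
    ∃ φ : Iso G H, (φ.flag h = k ∨ φ.flag h = H.inv k) ∧
      (∀ x, ψ.flag (Sum.inl x) = Sum.inl (φ.flag x)) ∧
      ∀ u, ψ.vert (some u) = some (φ.vert u) := by
  obtain ⟨ev, hev⟩ : ∃ ev : Option G.Vert ≃ Option H.Vert, ev = ψ.vert := ⟨_, rfl⟩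
  obtain ⟨e, he⟩ : ∃ e : G.Flag ⊕ Bool ≃ H.Flag ⊕ Bool, e = ψ.flag := ⟨_, rfl⟩
  have hroot : ∀ x, Sum.elim (fun x => some (H.root x)) (fun _ => none) (e x) =
      ev (Sum.elim (fun x => some (G.root x)) (fun _ => none) x) := he ▸ hev ▸ ψ.root_flag
  have hinv : ∀ x, H.subdivInv k (e x) = e (G.subdivInv h x) := he ▸ ψ.inv_flag
  have hleg : ∀ i, e (G.subdivLeg h i) = H.subdivLeg k i := he ▸ ψ.leg_flag
  have hgenus : ∀ v : Option G.Vert, (ev v).elim 0 H.vgenus = v.elim 0 G.vgenus :=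
    hev ▸ ψ.vgenus_vert
  have hev0 : ev none = none := hev ▸ hψ
  obtain ⟨fv, hfv⟩ := Equiv.exists_of_apply_none ev hev0
  have hl : ∀ x, ∃ y, e (Sum.inl x) = Sum.inl y := by
    intro x
    have hr := hroot (Sum.inl x)
    rcases hx : e (Sum.inl x) with y | b
    · exact ⟨y, rfl⟩
    · simp [hx, hfv] at hr
  have hr : ∀ b, ∃ b', e (Sum.inr b) = Sum.inr b' := by
    intro x
    have hr := hroot (Sum.inr x)
    rcases hx : e (Sum.inr x) with y | b
    · simp [hx, hev0] at hr
    · exact ⟨b, rfl⟩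
  obtain ⟨f, hf⟩ := Equiv.exists_of_apply_inl e hl hr
  have htrue := hinv (Sum.inr true)
  have hfalse := hinv (Sum.inr false)
  rw [subdivInv_true, hf] at htrue
  obtain ⟨b, hb⟩ := hr true
  obtain ⟨b', hb'⟩ := hr false
  have hbb' : b' = !b := by
    rcases b with _ | _ <;> rcases b' with _ | _ <;> try rfl
    all_goals
      have := e.injective (hb.trans hb'.symm)
      simp at this
  subst hbb'
  rw [hb] at htrue
  rw [hb'] at hfalse
  -- The value `b` at the flag `true` decides whether the edge of `h` is mapped to that of `k` with
  -- or without reversal. A leg admits no reversal, since only one of the two new flags is then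
  -- fixed by the involution.
  have key : (f h = k ∧ f (G.inv h) = H.inv k ∨ f h = H.inv k ∧ f (G.inv h) = k) ∧
      (G.inv h = h → f h = k) := by
    by_cases hh : G.inv h = h
    · rw [subdivInv_false_of_eq _ hh, hb'] at hfalse
      rcases b with _ | _
      · simp [subdivInv_true] at hfalse
      · rw [subdivInv_true] at htrue
        have h1 := Sum.inl_injective htrue
        by_cases hk : H.inv k = k
        · rw [hh, hk, h1]
          simp
        · simp [subdivInv_false _ hk] at hfalse
    · rw [subdivInv_false _ hh, hf] at hfalse
      rcases b with _ | _
      · by_cases hk : H.inv k = k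
        · simp [subdivInv_false_of_eq _ hk] at htrue
        · rw [subdivInv_false _ hk] at htrue
          rw [Bool.not_false, subdivInv_true] at hfalse
          exact ⟨Or.inr ⟨(Sum.inl_injective htrue).symm, (Sum.inl_injective hfalse).symm⟩,
            fun h => absurd h hh⟩
      · by_cases hk : H.inv k = k
        · simp [subdivInv_false_of_eq _ hk] at hfalse
        · rw [Bool.not_true, subdivInv_false _ hk] at hfalse
          rw [subdivInv_true] at htrue
          exact ⟨Or.inl ⟨(Sum.inl_injective htrue).symm, (Sum.inl_injective hfalse).symm⟩,
            fun h => absurd h hh⟩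
  refine ⟨⟨fv, f, fun x => ?_, fun x => ?_, fun i => ?_, fun v => ?_⟩, ?_,
    fun x => (congrArg (fun e => e (Sum.inl x)) he).symm.trans (hf x),
    fun x => (congrArg (fun e => e (some x)) hev).symm.trans (hfv x)⟩
  · simpa [hf, hfv] using hroot (Sum.inl x)
  · have h1 : H.inv (f h) = f (G.inv h) := by
      rcases key.1 with ⟨h1, h2⟩ | ⟨h1, h2⟩
      · rw [h1, h2]
      · rw [h1, h2, H.inv_inv]
    by_cases hx : x = h
    · rw [hx, h1]
    by_cases hx' : x = G.inv h
    · rw [hx', ← h1, H.inv_inv, G.inv_inv]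
    have h2 := hinv (Sum.inl x)
    rw [subdivInv_inl _ hx hx', hf, hf] at h2
    exact ((H.subdivInv_inl_eq_inl_iff k).mp h2).2.2
  · have h1 := hleg i
    rw [subdivLeg, subdivLeg] at h1
    by_cases hi : (G.leg i : G.Flag) = h
    · rw [if_pos hi, hb'] at h1
      split_ifs at h1 with h2
      rw [h2, hi]
      exact key.2 (by rw [← hi, G.inv_leg])
    · rw [if_neg hi, hf] at h1
      split_ifs at h1 with h2
      exact Sum.inl_injective h1
  · simpa [hfv] using hgenus (some v)
  · rcases key.1 with h1 | h1
    · exact Or.inl h1.1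
    · exact Or.inr h1.1

end Subdiv

/-! ### Smoothing a bivalent vertex -/

/-- A vertex of genus `0` with exactly two flags `a`, `b`, where `a` belongs to an edge which
is not a loop. -/
structure Bivalent (G : LabelledGraph n) (w : G.Vert) (a b : G.Flag) : Prop where
  root_eq_iff : ∀ x, G.root x = w ↔ x = a ∨ x = b
  ne : a ≠ b
  inv_ne_self : G.inv a ≠ a
  inv_ne : G.inv a ≠ b
  vgenus_eq : G.vgenus w = 0

namespace Bivalent

variable {G : LabelledGraph n} {w : G.Vert} {a b : G.Flag}

theorem root_left (h : G.Bivalent w a b) : G.root a = w := (h.root_eq_iff a).mpr (Or.inl rfl)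

theorem root_right (h : G.Bivalent w a b) : G.root b = w := (h.root_eq_iff b).mpr (Or.inr rfl)

theorem root_ne_iff (h : G.Bivalent w a b) {x : G.Flag} : G.root x ≠ w ↔ x ≠ a ∧ x ≠ b := by
  rw [Ne, h.root_eq_iff, not_or]

theorem inv_right_ne (h : G.Bivalent w a b) : G.inv b ≠ a := fun h' =>
  h.inv_ne (by rw [← h', G.inv_inv])

open Classical in
/-- The involution after smoothing a bivalent vertex. -/
noncomputable def smoothInv (_ : G.Bivalent w a b) (x : G.Flag) : G.Flag :=
  -- The outer ends `G.inv a` and `G.inv b` become partners; if `b` is a leg, `G.inv a` becomes the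
  -- leg in its place.
  if G.inv x = a then if G.inv b = b then x else G.inv b
  else if G.inv x = b then G.inv a else G.inv x

theorem root_smoothInv (h : G.Bivalent w a b) {x : G.Flag} (hx : G.root x ≠ w) :
    G.root (h.smoothInv x) ≠ w := by
  unfold smoothInv
  split_ifs with h1 h2 h3
  · exact hx
  · exact h.root_ne_iff.mpr ⟨h.inv_right_ne, h2⟩
  · exact h.root_ne_iff.mpr ⟨h.inv_ne_self, h.inv_ne⟩
  · exact h.root_ne_iff.mpr ⟨h1, h3⟩

theorem smoothInv_smoothInv (h : G.Bivalent w a b) {x : G.Flag} (hx : G.root x ≠ w) :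
    h.smoothInv (h.smoothInv x) = x := by
  have hx' := h.root_ne_iff.mp hx
  have hba := h.ne.symm
  by_cases h1 : G.inv x = a
  · by_cases h2 : G.inv b = b
    · simp [smoothInv, h1, h2]
    · have : h.smoothInv x = G.inv b := by simp [smoothInv, h1, h2]
      rw [this, smoothInv, G.inv_inv, if_neg hba, if_pos rfl, ← h1, G.inv_inv]
  · by_cases h3 : G.inv x = b
    · have h2 : G.inv b ≠ b := fun h2 => hx'.2 (by rw [G.inv_eq_iff.mp h3, h2])
      have : h.smoothInv x = G.inv a := by rw [smoothInv, if_neg h1, if_pos h3]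
      rw [this, smoothInv, G.inv_inv, if_pos rfl, if_neg h2, ← h3, G.inv_inv]
    · have : h.smoothInv x = G.inv x := by simp [smoothInv, h1, h3]
      rw [this, smoothInv, G.inv_inv, if_neg hx'.1, if_neg hx'.2]

open Classical in
/-- The legs after smoothing a bivalent vertex. -/
noncomputable def smoothLeg (_ : G.Bivalent w a b) (i : Fin n) : G.Flag :=
  if (G.leg i : G.Flag) = b then G.inv a else G.leg i

theorem root_smoothLeg (h : G.Bivalent w a b) (i : Fin n) : G.root (h.smoothLeg i) ≠ w := by
  unfold smoothLeg
  split_ifs with h1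
  · exact h.root_ne_iff.mpr ⟨h.inv_ne_self, h.inv_ne⟩
  · exact h.root_ne_iff.mpr ⟨fun h2 => h.inv_ne_self (by rw [← h2, G.inv_leg]), h1⟩

theorem smoothInv_smoothLeg (h : G.Bivalent w a b) (i : Fin n) :
    h.smoothInv (h.smoothLeg i) = h.smoothLeg i := by
  unfold smoothLeg
  split_ifs with h1
  · have h2 : G.inv b = b := by rw [← h1, G.inv_leg]
    rw [smoothInv, G.inv_inv, if_pos rfl, if_pos h2]
  · have h2 : (G.leg i : G.Flag) ≠ a := fun h2 => h.inv_ne_self (by rw [← h2, G.inv_leg])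
    rw [smoothInv, G.inv_leg, if_neg h2, if_neg h1]

theorem smoothLeg_injective (h : G.Bivalent w a b) : Function.Injective h.smoothLeg := by
  have key : ∀ i, (G.leg i : G.Flag) ≠ G.inv a := fun i hi => h.inv_ne_self (by
    rw [← hi, G.inv_eq_iff.mp hi.symm, G.inv_leg])
  intro i j hij
  unfold smoothLeg at hij
  split_ifs at hij with h1 h2 h2
  · exact G.leg_injective (h1.trans h2.symm)
  · exact absurd hij.symm (key j)
  · exact absurd hij (key i)
  · exact G.leg_injective hij

theorem exists_smoothLeg (h : G.Bivalent w a b) {x : G.Flag} (hx : G.root x ≠ w)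
    (hxx : h.smoothInv x = x) : ∃ i, h.smoothLeg i = x := by
  have hx' := h.root_ne_iff.mp hx
  unfold smoothInv at hxx
  split_ifs at hxx with h1 h2 h3
  · obtain ⟨i, hi⟩ := G.exists_leg h2
    exact ⟨i, by rw [smoothLeg, if_pos hi, ← h1, G.inv_inv]⟩
  · rw [G.inv_eq_iff.mp h1] at hxx
    exact absurd (G.inv_injective hxx) h.ne.symm
  · rw [G.inv_eq_iff.mp h3] at hxx
    exact absurd (G.inv_injective hxx) h.ne
  · obtain ⟨i, hi⟩ := G.exists_leg hxx
    exact ⟨i, by rw [smoothLeg, if_neg (by rw [hi]; exact hx'.2), hi]⟩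

open Classical in
/-- The graph in which a bivalent vertex is smoothed. -/
noncomputable def smooth (h : G.Bivalent w a b) : LabelledGraph n where
  Vert := {v : G.Vert // v ≠ w}
  Flag := {x : G.Flag // G.root x ≠ w}
  root x := ⟨G.root x, x.2⟩
  inv x := ⟨h.smoothInv x, h.root_smoothInv x.2⟩
  inv_inv x := Subtype.ext (h.smoothInv_smoothInv x.2)
  leg := legEquiv (fun i => ⟨h.smoothLeg i, h.root_smoothLeg i⟩)
    (fun i => Subtype.ext (h.smoothInv_smoothLeg i))
    (fun i j hij => h.smoothLeg_injective (Subtype.ext_iff.mp hij))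
    (fun x hx => by
      obtain ⟨i, hi⟩ := h.exists_smoothLeg x.2 (Subtype.ext_iff.mp hx)
      exact ⟨i, Subtype.ext hi⟩)
  vgenus v := G.vgenus v
  nonempty := ⟨⟨G.root (G.inv a), h.root_ne_iff.mpr ⟨h.inv_ne_self, h.inv_ne⟩⟩⟩
  connected := by
    have ha : G.root (G.inv a) ≠ w := h.root_ne_iff.mpr ⟨h.inv_ne_self, h.inv_ne⟩
    set r : {v : G.Vert // v ≠ w} → {v : G.Vert // v ≠ w} → Prop := fun u v =>
      ∃ x : {x : G.Flag // G.root x ≠ w}, (⟨G.root x, x.2⟩ : {v : G.Vert // v ≠ w}) = u ∧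
        (⟨G.root (h.smoothInv x), h.root_smoothInv x.2⟩ : {v : G.Vert // v ≠ w}) = v with hr
    -- Contract the edge of `a`: the vertex `w` is moved to its other end, and paths are projected
    -- along `p`.
    let p : G.Vert → {v : G.Vert // v ≠ w} := fun v =>
      if hv : v = w then ⟨G.root (G.inv a), ha⟩ else ⟨v, hv⟩
    have hpw : p w = ⟨G.root (G.inv a), ha⟩ := dif_pos rfl
    have hpv : ∀ v (hv : v ≠ w), p v = ⟨v, hv⟩ := fun v hv => dif_neg hv
    have key : ∀ u v, Relation.ReflTransGen r (p u) (p v) := by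
      intro u v
      refine Relation.ReflTransGen.lift' p ?_ _ _ (G.connected u v)
      rintro u v ⟨x, rfl, rfl⟩
      have hp2 : p (G.root b) = ⟨G.root (G.inv a), ha⟩ := by rw [h.root_right, hpw]
      have hp1 : p (G.root a) = ⟨G.root (G.inv a), ha⟩ := by rw [h.root_left, hpw]
      change Relation.ReflTransGen r (p (G.root x)) (p (G.root (G.inv x)))
      by_cases hxa : x = a
      · rw [hxa, hp1, hpv _ ha]
      by_cases hxb : x = b
      · rw [hxb, hp2]
        by_cases hb : G.inv b = b
        · rw [hb, hp2]
        · have hb' : G.root (G.inv b) ≠ w := h.root_ne_iff.mpr ⟨h.inv_right_ne, hb⟩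
          rw [hpv _ hb']
          refine Relation.ReflTransGen.single ⟨⟨G.inv a, ha⟩, rfl, Subtype.ext ?_⟩
          simp [smoothInv, G.inv_inv, hb]
      have hx : G.root x ≠ w := h.root_ne_iff.mpr ⟨hxa, hxb⟩
      rw [hpv _ hx]
      by_cases h1 : G.inv x = a
      · rw [h1, hp1]
        have : x = G.inv a := G.inv_eq_iff.mp h1
        subst this
        exact Relation.ReflTransGen.refl
      by_cases h2 : G.inv x = b
      · rw [h2, hp2]
        refine Relation.ReflTransGen.single ⟨⟨x, hx⟩, rfl, Subtype.ext ?_⟩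
        change G.root (h.smoothInv x) = _
        rw [smoothInv, if_neg h1, if_pos h2]
      · rw [hpv _ (h.root_ne_iff.mpr ⟨h1, h2⟩)]
        refine Relation.ReflTransGen.single ⟨⟨x, hx⟩, rfl, Subtype.ext ?_⟩
        change G.root (h.smoothInv x) = _
        rw [smoothInv, if_neg h1, if_neg h2]
    intro u v
    have := key u v
    rwa [hpv _ u.2, hpv _ v.2] at this

/-- The flag at which a smoothed graph has to be subdivided. -/
def flag (h : G.Bivalent w a b) : h.smooth.Flag :=
  (⟨G.inv a, h.root_ne_iff.mpr ⟨h.inv_ne_self, h.inv_ne⟩⟩ : {x : G.Flag // G.root x ≠ w})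

/-- The bijection of flags between the subdivided smoothing and the graph. -/
noncomputable def flagEquiv (h : G.Bivalent w a b) :
    {x : G.Flag // G.root x ≠ w} ⊕ Bool ≃ G.Flag :=
  Equiv.ofBijective (Sum.elim Subtype.val fun c => if c then a else b) (by
    constructor
    · have hne : ∀ (x : {x : G.Flag // G.root x ≠ w}) (c : Bool),
          (x : G.Flag) ≠ if c then a else b := by
        rintro ⟨x, hx⟩ (_ | _)
        · exact (h.root_ne_iff.mp hx).2
        · exact (h.root_ne_iff.mp hx).1
      refine Function.Injective.sumElim Subtype.val_injective ?_ hne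
      rintro (_ | _) (_ | _) hc
      · rfl
      · exact absurd hc h.ne.symm
      · exact absurd hc h.ne
      · rfl
    · intro x
      by_cases hx : G.root x = w
      · rcases (h.root_eq_iff x).mp hx with rfl | rfl
        · exact ⟨Sum.inr true, rfl⟩
        · exact ⟨Sum.inr false, rfl⟩
      · exact ⟨Sum.inl ⟨x, hx⟩, rfl⟩)

open Classical in
/-- Subdividing after smoothing. -/
noncomputable def subdivSmooth (h : G.Bivalent w a b) : Iso (h.smooth.subdiv h.flag) G where
  vert := Equiv.optionSubtypeNe w
  flag := h.flagEquiv
  root_flag x := by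
    rcases x with x | _ | _
    · rfl
    · exact h.root_right
    · exact h.root_left
  inv_flag x := by
    change G.inv (h.flagEquiv x) = h.flagEquiv (h.smooth.subdivInv h.flag x)
    have hfl : h.smooth.inv h.flag = h.flag ↔ G.inv b = b := by
      change (⟨_, _⟩ : {x : G.Flag // G.root x ≠ w}) = ⟨_, _⟩ ↔ _
      rw [Subtype.mk.injEq]
      change h.smoothInv (G.inv a) = G.inv a ↔ _
      rw [smoothInv, G.inv_inv, if_pos rfl]
      split_ifs with hb
      · simp [hb]
      · simp only [hb, iff_false]
        exact fun h' => h.ne (G.inv_injective h').symm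
    have hfl' : G.inv b ≠ b → (h.smooth.inv h.flag).1 = G.inv b := by
      intro hb
      change h.smoothInv (G.inv a) = _
      rw [smoothInv, G.inv_inv, if_pos rfl, if_neg hb]
    rcases x with x | _ | _
    · by_cases h1 : x = h.flag
      · rw [h1, subdivInv_self]
        exact G.inv_inv a
      by_cases h2 : x = h.smooth.inv h.flag
      · have h3 : h.smooth.inv h.flag ≠ h.flag := fun h3 => h1 (h2.trans h3)
        rw [h2, subdivInv_inv _ h3]
        change G.inv (h.smooth.inv h.flag).1 = b
        rw [hfl' (fun hb => h3 (hfl.mpr hb)), G.inv_inv]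
      · rw [subdivInv_inl _ h1 h2]
        change G.inv x.1 = h.smoothInv x.1
        have h3 : G.inv x.1 ≠ a := fun h3 => h1 (Subtype.ext (G.inv_eq_iff.mp h3))
        have h4 : G.inv x.1 ≠ b := fun h4 => by
          have hx := G.inv_eq_iff.mp h4
          have hb : G.inv b ≠ b := fun hb => (h.root_ne_iff.mp x.2).2 (hx.trans hb)
          exact h2 (Subtype.ext (hx.trans (hfl' hb).symm))
        rw [smoothInv, if_neg h3, if_neg h4]
    · by_cases hb : G.inv b = b
      · rw [subdivInv_false_of_eq _ (hfl.mpr hb)]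
        exact hb
      · rw [subdivInv_false _ (fun h' => hb (hfl.mp h'))]
        exact (hfl' hb).symm
    · rfl
  leg_flag i := by
    change h.flagEquiv (h.smooth.subdivLeg h.flag i) = G.leg i
    rw [subdivLeg]
    have key : (h.smooth.leg i : h.smooth.Flag) = h.flag ↔ (G.leg i : G.Flag) = b := by
      change (⟨_, _⟩ : {x : G.Flag // G.root x ≠ w}) = ⟨_, _⟩ ↔ _
      rw [Subtype.mk.injEq]
      unfold smoothLeg
      split_ifs with h1
      · simp [h1]
      · simp only [h1, iff_false]
        intro h2
        exact h.inv_ne_self (by rw [← h2, G.inv_eq_iff.mp h2.symm, G.inv_leg])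
    by_cases h1 : (G.leg i : G.Flag) = b
    · rw [if_pos (key.mpr h1), h1]
      rfl
    · rw [if_neg (fun h2 => h1 (key.mp h2))]
      change h.smoothLeg i = _
      rw [smoothLeg, if_neg h1]
  vgenus_vert v := by
    rcases v with _ | v
    · exact h.vgenus_eq
    · rfl

theorem subdivSmooth_vert (h : G.Bivalent w a b) : h.subdivSmooth.vert none = w := by
  rfl

end Bivalent
end LabelledGraph
-- Counting flags, edges and valences.
open Classical in
/-- Counting the orbits of an involution: a map on `S` whose fibres are the orbits of `σ`. -/
theorem two_mul_card_eq_of_involution {F Q : Type*} {σ : F → F} {f : F → Q} {S : Finset F}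
    {T : Finset Q} (hσ : ∀ x, σ (σ x) = x) (hS : ∀ x ∈ S, σ x ∈ S) (hT : ∀ x ∈ S, f x ∈ T)
    (hf : ∀ x ∈ S, ∀ y ∈ S, f x = f y ↔ y = x ∨ y = σ x) (hsurj : ∀ q ∈ T, ∃ x ∈ S, f x = q) :
    2 * T.card = S.card + (S.filter fun x => σ x = x).card := by
  rw [Finset.card_eq_sum_card_fiberwise (f := f) (t := T) (s := S) (fun x hx => hT x hx),
    Finset.card_eq_sum_card_fiberwise (f := f) (t := T) (s := S.filter fun x => σ x = x)
      (fun x hx => hT x (Finset.mem_filter.mp hx).1), ← Finset.sum_add_distrib,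
    Finset.sum_congr rfl (g := fun _ => 2), Finset.sum_const, smul_eq_mul, mul_comm]
  intro q hq
  obtain ⟨x, hx, rfl⟩ := hsurj q hq
  -- An orbit with two elements contributes 2 to the first summand; a fixed point contributes 1 to
  -- each summand.
  by_cases hxx : σ x = x
  · have h1 : (S.filter fun a => f a = f x) = {x} := by
      ext y
      simp only [Finset.mem_filter, Finset.mem_singleton]
      constructor
      · rintro ⟨hy, h⟩
        rcases (hf x hx y hy).mp h.symm with h | h
        · exact h
        · rw [h, hxx]
      · rintro rfl
        exact ⟨hx, rfl⟩
    have h2 : ((S.filter fun x => σ x = x).filter fun a => f a = f x) = {x} := by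
      rw [Finset.filter_filter]
      ext y
      have h3 := Finset.ext_iff.mp h1 y
      simp only [Finset.mem_filter, Finset.mem_singleton] at h3 ⊢
      constructor
      · rintro ⟨hy, -, h⟩
        exact h3.mp ⟨hy, h⟩
      · rintro rfl
        exact ⟨hx, hxx, rfl⟩
    rw [h1, h2, Finset.card_singleton]
  · have h1 : (S.filter fun a => f a = f x) = {x, σ x} := by
      ext y
      simp only [Finset.mem_filter, Finset.mem_singleton, Finset.mem_insert]
      constructor
      · rintro ⟨hy, h⟩
        exact (hf x hx y hy).mp h.symm
      · rintro (rfl | rfl)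
        · exact ⟨hx, rfl⟩
        · exact ⟨hS x hx, ((hf x hx _ (hS x hx)).mpr (Or.inr rfl)).symm⟩
    have h2 : ((S.filter fun x => σ x = x).filter fun a => f a = f x) = ∅ := by
      rw [Finset.filter_filter]
      ext y
      have h3 := Finset.ext_iff.mp h1 y
      simp only [Finset.mem_filter, Finset.mem_singleton, Finset.mem_insert] at h3
      simp only [Finset.mem_filter, Finset.notMem_empty, iff_false]
      rintro ⟨hy, hyy, h⟩
      rcases h3.mp ⟨hy, h⟩ with rfl | rfl
      · exact hxx hyy
      · rw [hσ] at hyy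
        exact hxx hyy.symm
    rw [h1, h2, Finset.card_pair (Ne.symm hxx), Finset.card_empty]

open Classical in
theorem Nat.card_fiber_eq_sum {F V : Type*} [Fintype F] (r : F → V) (v : V) :
    Nat.card {h // r h = v} = ∑ h, if r h = v then 1 else 0 := by
  rw [Nat.card_eq_fintype_card, Fintype.card_subtype, Finset.card_filter]

namespace LabelledGraph

variable {n : ℕ}

section Counting

variable (G : LabelledGraph n)

open Classical in
theorem card_fixed : (Finset.univ.filter fun h => G.inv h = h).card = n := by
  rw [← Fintype.card_subtype, ← Fintype.card_congr G.leg, Fintype.card_fin]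

open Classical in
theorem two_mul_card_edge : 2 * Nat.card G.Edge + n = Fintype.card G.Flag := by
  set S : Finset G.Flag := Finset.univ.filter fun h => G.inv h ≠ h with hS
  let f : G.Flag → Set G.Flag := fun h => {h, G.inv h}
  have hfix : S.filter (fun x => G.inv x = x) = ∅ := by
    ext x
    simp [hS]
  have key := two_mul_card_eq_of_involution (S := S) (T := S.image f) (f := f) G.inv_inv
    (fun x hx => by
      simp only [hS, Finset.mem_filter, Finset.mem_univ, true_and] at hx ⊢
      exact fun h => hx (G.inv_injective h))
    (fun x hx => Finset.mem_image_of_mem f hx)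
    (fun x _ y _ => by
      constructor
      · intro h
        have : y ∈ f x := by
          rw [h]
          exact Set.mem_insert _ _
        simpa [f] using this
      · rintro (rfl | rfl)
        · rfl
        · simp only [f, G.inv_inv]
          exact Set.pair_comm _ _)
    (fun q hq => by simpa using hq)
  have hE : Nat.card G.Edge = (S.image f).card := by
    refine Nat.subtype_card _ fun e => ?_
    simp only [Finset.mem_image, hS, Finset.mem_filter, Finset.mem_univ, true_and, f]
    exact ⟨fun ⟨h, h1, h2⟩ => ⟨h, h1, h2.symm⟩, fun ⟨h, h1, h2⟩ => ⟨h, h1, h2.symm⟩⟩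
  have hn := Finset.card_filter_add_card_filter_not (s := Finset.univ) (fun h => G.inv h = h)
  rw [G.card_fixed, Finset.card_univ, add_comm] at hn
  rw [hE, key, hfix, Finset.card_empty, add_zero]
  exact hn

theorem sum_valence : ∑ v, G.valence v = Fintype.card G.Flag := by
  classical
  simp only [valence, Nat.card_fiber_eq_sum]
  rw [Finset.sum_comm]
  simp

theorem valence_pos_iff {v : G.Vert} : 0 < G.valence v ↔ ∃ h, G.root h = v := by
  rw [valence, Nat.card_pos_iff]
  exact ⟨fun h => ⟨h.1.some.1, h.1.some.2⟩, fun ⟨h, hh⟩ => ⟨⟨⟨h, hh⟩⟩, inferInstance⟩⟩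

end Counting

open Classical in
theorem valence_attach (G : LabelledGraph n) (v u : G.Vert) :
    (G.attach v).valence u = G.valence u + if v = u then 1 else 0 := by
  change Nat.card {h : Option G.Flag // h.elim v G.root = u} = _
  rw [Nat.card_fiber_eq_sum, Fintype.sum_option, valence, Nat.card_fiber_eq_sum, add_comm]
  rfl

theorem valence_subdiv_some (G : LabelledGraph n) (h : G.Flag) (v : G.Vert) :
    (G.subdiv h).valence (some v) = G.valence v := by
  classical
  change Nat.card {x : G.Flag ⊕ Bool //
    Sum.elim (fun x => some (G.root x)) (fun _ => none) x = some v} = _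
  rw [Nat.card_fiber_eq_sum, Fintype.sum_sum_type, valence, Nat.card_fiber_eq_sum]
  simp

theorem valence_subdiv_none (G : LabelledGraph n) (h : G.Flag) :
    (G.subdiv h).valence none = 2 := by
  classical
  change Nat.card {x : G.Flag ⊕ Bool //
    Sum.elim (fun x => some (G.root x)) (fun _ => none) x = none} = _
  rw [Nat.card_fiber_eq_sum, Fintype.sum_sum_type]
  simp

theorem Iso.valence_vert {G H : LabelledGraph n} (φ : Iso G H) (v : G.Vert) :
    H.valence (φ.vert v) = G.valence v := by
  refine (Nat.card_congr (φ.flag.subtypeEquiv fun h => ?_)).symm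
  rw [φ.root_flag, φ.vert.apply_eq_iff_eq]

theorem card_attach_flag (G : LabelledGraph n) (v : G.Vert) :
    Fintype.card (G.attach v).Flag = Fintype.card G.Flag + 1 :=
  Fintype.card_option

theorem card_attach_vert (G : LabelledGraph n) (v : G.Vert) :
    Fintype.card (G.attach v).Vert = Fintype.card G.Vert := rfl

theorem card_subdiv_flag (G : LabelledGraph n) (h : G.Flag) :
    Fintype.card (G.subdiv h).Flag = Fintype.card G.Flag + 2 :=
  (Fintype.card_sum (α := G.Flag) (β := Bool)).trans (by rw [Fintype.card_bool])

theorem card_subdiv_vert (G : LabelledGraph n) (h : G.Flag) :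
    Fintype.card (G.subdiv h).Vert = Fintype.card G.Vert + 1 :=
  Fintype.card_option

/-! ### Stable graphs of genus 1 and removal of the last leg. -/

/-- Stable graphs of genus `1` all of whose vertices have genus `0`. -/
structure Good (G : LabelledGraph n) : Prop where
  vgenus_eq : ∀ v, G.vgenus v = 0
  three_le_valence : ∀ v, 3 ≤ G.valence v
  -- Genus 1 with vanishing vertex genera means |Edge| = |Vert|, while |Flag| = 2 |Edge| + n always
  -- holds.
  card_flag : Fintype.card G.Flag = 2 * Fintype.card G.Vert + n

theorem good_iff {G : LabelledGraph n} :
    G.Good ↔ (G.IsStable ∧ G.genus = ((1 : ℕ) : ℤ)) ∧ ∀ v, G.vgenus v = 0 := by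
  have hE := G.two_mul_card_edge
  constructor
  · intro h
    refine ⟨⟨fun v => ?_, ?_⟩, h.vgenus_eq⟩
    · have := h.three_le_valence v
      rw [h.vgenus_eq]
      push_cast
      omega
    · have := h.card_flag
      simp only [genus, h.vgenus_eq, Nat.card_eq_fintype_card (α := G.Vert)]
      simp
      omega
  · rintro ⟨⟨h1, h2⟩, h3⟩
    refine ⟨h3, fun v => ?_, ?_⟩
    · have := h1 v
      rw [h3] at this
      push_cast at this
      omega
    · simp only [genus, h3, Nat.card_eq_fintype_card (α := G.Vert)] at h2
      simp at h2
      omega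

theorem Good.of_iso {G H : LabelledGraph n} (hG : G.Good) (φ : Iso G H) : H.Good where
  vgenus_eq v := by
    rw [← φ.vert.apply_symm_apply v, φ.vgenus_vert, hG.vgenus_eq]
  three_le_valence v := by
    rw [← φ.vert.apply_symm_apply v, φ.valence_vert]
    exact hG.three_le_valence _
  card_flag := by
    rw [← Fintype.card_congr φ.flag, ← Fintype.card_congr φ.vert, hG.card_flag]

theorem Good.attach {G : LabelledGraph n} (hG : G.Good) (v : G.Vert) : (G.attach v).Good where
  vgenus_eq := hG.vgenus_eq
  three_le_valence u := by
    classical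
    exact (le_add_right (hG.three_le_valence u)).trans_eq (valence_attach G v u).symm
  card_flag := by
    rw [card_attach_flag, card_attach_vert, hG.card_flag]
    ring

theorem Good.of_attach {G : LabelledGraph n} {v : G.Vert} (hG : (G.attach v).Good)
    (hv : 3 ≤ G.valence v) : G.Good where
  vgenus_eq := hG.vgenus_eq
  three_le_valence u := by
    classical
    have := hG.three_le_valence u
    rw [valence_attach] at this
    split_ifs at this with h
    · rwa [← h]
    · exact this
  card_flag := by
    have := hG.card_flag
    rw [card_attach_flag, card_attach_vert] at this
    omega

/-- The new vertex of a subdivided graph. -/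
def subdivVert (G : LabelledGraph n) (h : G.Flag) : (G.subdiv h).Vert := (none : Option G.Vert)

/-- Inserting a leg into an edge or a leg. -/
noncomputable def insertLeg (G : LabelledGraph n) (h : G.Flag) : LabelledGraph (n + 1) :=
  (G.subdiv h).attach (G.subdivVert h)

theorem valence_insertLeg_none (G : LabelledGraph n) (h : G.Flag) :
    (G.insertLeg h).valence (none : Option G.Vert) = 3 := by
  classical
  refine (valence_attach (G.subdiv h) (G.subdivVert h) (G.subdivVert h)).trans ?_
  rw [if_pos rfl]
  exact congrArg (· + 1) (valence_subdiv_none G h)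

theorem valence_insertLeg_some (G : LabelledGraph n) (h : G.Flag) (v : G.Vert) :
    (G.insertLeg h).valence (some v : Option G.Vert) = G.valence v := by
  classical
  refine (valence_attach (G.subdiv h) (G.subdivVert h) (some v : Option G.Vert)).trans ?_
  rw [if_neg (by exact fun h => by cases h)]
  exact valence_subdiv_some G h v

theorem card_insertLeg_flag (G : LabelledGraph n) (h : G.Flag) :
    Fintype.card (G.insertLeg h).Flag = Fintype.card G.Flag + 3 :=
  (card_attach_flag _ _).trans (by rw [card_subdiv_flag])

theorem card_insertLeg_vert (G : LabelledGraph n) (h : G.Flag) :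
    Fintype.card (G.insertLeg h).Vert = Fintype.card G.Vert + 1 :=
  card_subdiv_vert G h

theorem good_insertLeg_iff {G : LabelledGraph n} {h : G.Flag} :
    (G.insertLeg h).Good ↔ G.Good := by
  constructor
  · intro hG
    refine ⟨fun v => hG.vgenus_eq (some v : Option G.Vert), fun v => ?_, ?_⟩
    · rw [← valence_insertLeg_some]
      exact hG.three_le_valence (some v : Option G.Vert)
    · have := hG.card_flag
      rw [card_insertLeg_flag, card_insertLeg_vert] at this
      omega
  · intro hG
    refine ⟨fun v => ?_, fun v => ?_, ?_⟩
    · rcases v with _ | v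
      · rfl
      · exact hG.vgenus_eq v
    · rcases v with _ | v
      · exact (valence_insertLeg_none G h).ge
      · exact (hG.three_le_valence v).trans_eq (valence_insertLeg_some G h v).symm
    · rw [card_insertLeg_flag, card_insertLeg_vert, hG.card_flag]
      ring

theorem eq_of_closed (G : LabelledGraph n) {w : G.Vert}
    (h : ∀ x, G.root x = w → G.root (G.inv x) = w) (v : G.Vert) : v = w := by
  induction G.connected w v with
  | refl => rfl
  | tail _ h2 ih =>
    obtain ⟨x, hx, rfl⟩ := h2
    exact h x (hx.trans ih)

/-- Every stable graph with at least two legs arises by inserting the last leg. -/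
theorem Good.exists_iso {G : LabelledGraph (n + 1)} (hG : G.Good) (hn : 1 ≤ n) :
    (∃ H : LabelledGraph n, H.Good ∧ ∃ v, Nonempty (Iso (H.attach v) G)) ∨
      ∃ H : LabelledGraph n, H.Good ∧ ∃ h, Nonempty (Iso (H.insertLeg h) G) := by
  classical
  obtain ⟨H, w, ⟨ψ⟩⟩ : ∃ H : LabelledGraph n, ∃ w, Nonempty (Iso (H.attach w) G) :=
    ⟨G.detach, _, ⟨G.attachDetach⟩⟩
  have hH := hG.of_iso ψ.symm
  -- Only the vertex `w` of the removed leg can have become unstable. In that case it has valence 2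
  -- and has to be smoothed, using a flag whose edge leaves `w`.
  by_cases hw : 3 ≤ H.valence w
  · exact Or.inl ⟨H, hH.of_attach hw, w, ⟨ψ⟩⟩
  right
  have hw2 : H.valence w = 2 := by
    have := hH.three_le_valence w
    rw [valence_attach, if_pos rfl] at this
    omega
  obtain ⟨⟨a, ha⟩, ⟨b, hb⟩, hab, huniv⟩ := Nat.card_eq_two_iff.mp hw2
  have hroot : ∀ x, H.root x = w ↔ x = a ∨ x = b := by
    intro x
    constructor
    · intro hx
      have : (⟨x, hx⟩ : {h // H.root h = w}) ∈ ({⟨a, ha⟩, ⟨b, hb⟩} : Set _) := by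
        rw [huniv]
        trivial
      simpa using this
    · rintro (rfl | rfl) <;> assumption
  have hne : a ≠ b := fun h => hab (Subtype.ext h)
  have main : ∀ a b, (∀ x, H.root x = w ↔ x = a ∨ x = b) → a ≠ b → H.inv a ≠ a → H.inv a ≠ b →
      ∃ H : LabelledGraph n, H.Good ∧ ∃ h, Nonempty (Iso (H.insertLeg h) G) := by
    intro a b h1 h2 h3 h4
    have B : H.Bivalent w a b := ⟨h1, h2, h3, h4, hH.vgenus_eq w⟩
    have χ : Iso (B.smooth.insertLeg B.flag) G :=
      (B.subdivSmooth.attach B.subdivSmooth_vert).trans ψ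
    exact ⟨B.smooth, good_insertLeg_iff.mp (hG.of_iso χ.symm), B.flag, ⟨χ⟩⟩
  by_cases h1 : H.inv a = a ∨ H.inv a = b
  · by_cases h2 : H.inv b = b ∨ H.inv b = a
    · exfalso
      have hV := H.eq_of_closed (w := w) (fun x hx => by
        rcases (hroot x).mp hx with rfl | rfl
        · exact (hroot _).mpr h1
        · exact (hroot _).mpr h2.symm)
      have hV1 : Fintype.card H.Vert = 1 := Fintype.card_eq_one_iff.mpr ⟨w, hV⟩
      have hF : Fintype.card H.Flag = 2 := by
        rw [← hw2, ← sum_valence, Finset.sum_eq_single w]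
        · exact fun v _ hv => absurd (hV v) hv
        · simp
      have := hH.card_flag
      rw [card_attach_flag, card_attach_vert] at this
      omega
    · push Not at h2
      exact main b a (fun x => by rw [hroot, or_comm]) hne.symm h2.1 h2.2
  · push Not at h1
    exact main a b hroot hne h1.1 h1.2

/-- The graph with one vertex, one loop and no legs. -/
def bareLoop : LabelledGraph 0 where
  Vert := Unit
  Flag := Bool
  root _ := ()
  inv := Bool.not
  inv_inv := Bool.not_not
  leg :=
    { toFun := fun i => i.elim0
      invFun := fun h => absurd h.2 (by cases h.1 <;> simp)
      left_inv := fun i => i.elim0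
      right_inv := fun h => absurd h.2 (by cases h.1 <;> simp) }
  vgenus _ := 0
  nonempty := ⟨()⟩
  connected _ _ := Relation.ReflTransGen.refl

/-- The graph with one vertex, one loop and one leg. -/
noncomputable def loopGraph : LabelledGraph 1 := bareLoop.attach (() : Unit)

theorem good_loopGraph : loopGraph.Good where
  vgenus_eq _ := rfl
  three_le_valence v := by
    classical
    refine le_of_le_of_eq ?_ (valence_attach bareLoop (() : Unit) v).symm
    have h : bareLoop.valence v = 2 := by
      change Nat.card {_h : Bool // () = ()} = 2
      simp
    rw [if_pos (by rfl), h]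
  card_flag := card_attach_flag bareLoop (() : Unit)

theorem Good.nonempty_iso_of_one {G : LabelledGraph 1} (hG : G.Good) :
    Nonempty (Iso loopGraph G) := by
  classical
  obtain ⟨H, w, ⟨ψ⟩⟩ : ∃ H : LabelledGraph 0, ∃ w, Nonempty (Iso (H.attach w) G) :=
    ⟨G.detach, _, ⟨G.attachDetach⟩⟩
  have hH := hG.of_iso ψ.symm
  have hF := hH.card_flag
  -- With one leg there are 2V + 1 flags, while stability requires at least 3V.
  have hV : Fintype.card H.Vert = 1 := by
    have h1 := (H.attach w).sum_valence
    have h2 := Finset.card_nsmul_le_sum Finset.univ _ 3 fun v _ => hH.three_le_valence v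
    rw [h1, hF, Finset.card_univ, smul_eq_mul, card_attach_vert] at h2
    have h3 := Fintype.card_pos_iff.mpr H.nonempty
    omega
  rw [card_attach_flag, card_attach_vert, hV] at hF
  have hfix : ∀ h, H.inv h ≠ h := fun h hh => (H.exists_leg hh).choose.elim0
  have hsub : Subsingleton H.Vert := Fintype.card_le_one_iff_subsingleton.mp hV.le
  obtain ⟨a⟩ : Nonempty H.Flag := Fintype.card_pos_iff.mp (by omega)
  let f : Bool → H.Flag := fun c => if c then a else H.inv a
  have hf : Function.Bijective f := by
    rw [Fintype.bijective_iff_injective_and_card]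
    refine ⟨?_, by rw [Fintype.card_bool]; omega⟩
    rintro (_ | _) (_ | _) hc
    · rfl
    · exact absurd hc (hfix a)
    · exact absurd hc.symm (hfix a)
    · rfl
  let φ : Iso bareLoop H :=
    { vert := ⟨fun _ => w, fun _ => (), fun _ => rfl, fun _ => Subsingleton.elim _ _⟩
      flag := Equiv.ofBijective f hf
      root_flag := fun _ => Subsingleton.elim _ _
      inv_flag := by
        rintro (_ | _)
        · exact H.inv_inv a
        · rfl
      leg_flag := fun i => i.elim0
      vgenus_vert := fun v => hH.vgenus_eq _ }
  exact ⟨(φ.attach (Subsingleton.elim _ _)).trans ψ⟩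

theorem Iso.flag_inv {G H : LabelledGraph n} (φ : Iso G H) (h : G.Flag) :
    φ.flag (G.inv h) = H.inv (φ.flag h) := (φ.inv_flag h).symm

/-! ### The three kinds of automorphism groups -/

/-- The automorphisms move at most the two flags of the loop at `h`. -/
structure LoopAt (G : LabelledGraph n) (h : G.Flag) : Prop where
  inv_ne : G.inv h ≠ h
  root_inv : G.root (G.inv h) = G.root h
  -- The flip need not be exhibited as an automorphism: `h` and `G.inv h` belong to the same class
  -- in `Loc` in any case.
  aut : ∀ (φ : Iso G G) x, x ≠ h → x ≠ G.inv h → φ.flag x = x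

/-- The only nontrivial automorphism exchanges the parallel edges of `h` and `k`. -/
structure DigonAt (G : LabelledGraph n) (h k : G.Flag) : Prop where
  inv_left_ne : G.inv h ≠ h
  inv_right_ne : G.inv k ≠ k
  ne : h ≠ k
  inv_ne : G.inv h ≠ k
  root_eq : G.root h = G.root k
  root_inv_eq : G.root (G.inv h) = G.root (G.inv k)
  aut : ∀ φ : Iso G G, (∀ x, φ.flag x = x) ∨ φ.flag h = k ∧ φ.flag k = h ∧
    ∀ x, x ≠ h → x ≠ G.inv h → x ≠ k → x ≠ G.inv k → φ.flag x = x

/-- All automorphisms are trivial. -/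
def Rigid (G : LabelledGraph n) : Prop := ∀ (φ : Iso G G) x, φ.flag x = x

/-- The kinds of stable graphs of genus `1`: the cycle is a loop, consists of two edges, or is
longer. -/
inductive Kind
  | loop
  | digon
  | rigid

/-- The kind after subdividing an edge of the cycle. -/
def Kind.next : Kind → Kind
  | loop => digon
  | digon => rigid
  | rigid => rigid

/-- The graphs of a given kind, in terms of their automorphisms. -/
def HasKind (G : LabelledGraph n) : Kind → Prop
  | Kind.loop => ∃ h, G.LoopAt h
  | Kind.digon => ∃ h k, G.DigonAt h k
  | Kind.rigid => G.Rigid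

/-- Two flags are related if an automorphism exchanges their edges or legs. -/
def edgeSetoid (G : LabelledGraph n) : Setoid G.Flag where
  r h k := ∃ φ : Iso G G, φ.flag h = k ∨ φ.flag h = G.inv k
  iseqv :=
    { refl := fun h => ⟨Iso.refl G, Or.inl rfl⟩
      symm := by
        rintro h k ⟨φ, hφ | hφ⟩
        · exact ⟨φ.symm, Or.inl (by rw [← hφ]; exact φ.flag.symm_apply_apply h)⟩
        · refine ⟨φ.symm, Or.inr ?_⟩
          change φ.flag.symm k = G.inv h
          rw [φ.flag.symm_apply_eq, φ.flag_inv, hφ, G.inv_inv]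
      trans := by
        rintro h k l ⟨φ, hφ⟩ ⟨χ, hχ⟩
        refine ⟨φ.trans χ, ?_⟩
        change χ.flag (φ.flag h) = l ∨ χ.flag (φ.flag h) = G.inv l
        rcases hφ with hφ | hφ <;> rcases hχ with hχ | hχ <;> rw [hφ]
        · exact Or.inl hχ
        · exact Or.inr hχ
        · exact Or.inr (by rw [χ.flag_inv, hχ])
        · exact Or.inl (by rw [χ.flag_inv, hχ, G.inv_inv]) }

/-- The edges and legs up to automorphisms. -/
def Loc (G : LabelledGraph n) : Type := Quotient G.edgeSetoid

noncomputable instance (G : LabelledGraph n) : Fintype G.Loc :=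
  @Fintype.ofFinite _ (Quotient.finite _)

/-- The class of a flag. -/
def loc (G : LabelledGraph n) (h : G.Flag) : G.Loc := Quotient.mk _ h

/-- A representative of a class of flags. -/
noncomputable def Loc.out {G : LabelledGraph n} (q : G.Loc) : G.Flag := Quotient.out q

theorem Loc.loc_out {G : LabelledGraph n} (q : G.Loc) : G.loc q.out = q := Quotient.out_eq q

theorem loc_eq_iff {G : LabelledGraph n} {h k : G.Flag} :
    G.loc h = G.loc k ↔ ∃ φ : Iso G G, φ.flag h = k ∨ φ.flag h = G.inv k :=
  Quotient.eq

theorem loc_inv (G : LabelledGraph n) (h : G.Flag) : G.loc (G.inv h) = G.loc h :=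
  loc_eq_iff.mpr ⟨Iso.refl G, Or.inr rfl⟩

theorem loc_eq_of_eq_or {G : LabelledGraph n} {h k : G.Flag} (hk : k = h ∨ k = G.inv h) :
    G.loc h = G.loc k := by
  rcases hk with rfl | rfl
  · rfl
  · exact (G.loc_inv h).symm

section LoopAt

variable {G : LabelledGraph n} {h : G.Flag}

theorem LoopAt.inv (L : G.LoopAt h) : G.LoopAt (G.inv h) :=
  ⟨by rw [G.inv_inv]; exact L.inv_ne.symm, by rw [G.inv_inv]; exact L.root_inv.symm,
    fun φ x h1 h2 => L.aut φ x (by rwa [G.inv_inv] at h2) h1⟩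

theorem LoopAt.flag_eq_or (L : G.LoopAt h) (φ : Iso G G) (x : G.Flag) :
    φ.flag x = x ∨ φ.flag x = G.inv x := by
  have key : φ.flag h = h ∨ φ.flag h = G.inv h := by
    by_contra! hc
    have := φ.flag.injective (L.aut φ _ hc.1 hc.2)
    exact hc.1 this
  by_cases h1 : x = h
  · rwa [h1]
  by_cases h2 : x = G.inv h
  · rw [h2, φ.flag_inv]
    exact key.imp (congrArg _) (congrArg _)
  · exact Or.inl (L.aut φ x h1 h2)

theorem LoopAt.root_flag (L : G.LoopAt h) (φ : Iso G G) (x : G.Flag) :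
    G.root (φ.flag x) = G.root x := by
  by_cases h1 : x = h
  · rcases L.flag_eq_or φ x with h2 | h2
    · rw [h2]
    · rw [h2, h1, L.root_inv]
  by_cases h3 : x = G.inv h
  · rcases L.flag_eq_or φ x with h2 | h2
    · rw [h2]
    · rw [h2, h3, G.inv_inv, L.root_inv]
  · rw [L.aut φ x h1 h3]

end LoopAt

section DigonAt

variable {G : LabelledGraph n} {h k : G.Flag}

theorem DigonAt.inv_ne' (D : G.DigonAt h k) : G.inv k ≠ h := fun h' =>
  D.inv_ne (G.inv_eq_iff.mpr h'.symm)

open Classical in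
/-- The permutation of the flags exchanging two parallel edges. -/
noncomputable def DigonAt.perm (_ : G.DigonAt h k) : Equiv.Perm G.Flag :=
  (Equiv.swap h k).trans (Equiv.swap (G.inv h) (G.inv k))

theorem DigonAt.perm_left (D : G.DigonAt h k) : D.perm h = k := by
  classical
  rw [perm, Equiv.trans_apply, Equiv.swap_apply_left,
    Equiv.swap_apply_of_ne_of_ne D.inv_ne.symm D.inv_right_ne.symm]

theorem DigonAt.perm_right (D : G.DigonAt h k) : D.perm k = h := by
  classical
  rw [perm, Equiv.trans_apply, Equiv.swap_apply_right,
    Equiv.swap_apply_of_ne_of_ne D.inv_left_ne.symm D.inv_ne'.symm]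

theorem DigonAt.perm_inv_left (D : G.DigonAt h k) : D.perm (G.inv h) = G.inv k := by
  classical
  rw [perm, Equiv.trans_apply, Equiv.swap_apply_of_ne_of_ne D.inv_left_ne D.inv_ne,
    Equiv.swap_apply_left]

theorem DigonAt.perm_inv_right (D : G.DigonAt h k) : D.perm (G.inv k) = G.inv h := by
  classical
  rw [perm, Equiv.trans_apply, Equiv.swap_apply_of_ne_of_ne D.inv_ne' D.inv_right_ne,
    Equiv.swap_apply_right]

theorem DigonAt.perm_of_ne (D : G.DigonAt h k) {x : G.Flag} (h1 : x ≠ h) (h2 : x ≠ k)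
    (h3 : x ≠ G.inv h) (h4 : x ≠ G.inv k) : D.perm x = x := by
  classical
  rw [perm, Equiv.trans_apply, Equiv.swap_apply_of_ne_of_ne h1 h2,
    Equiv.swap_apply_of_ne_of_ne h3 h4]

/-- The automorphism exchanging two parallel edges. -/
noncomputable def DigonAt.swap (D : G.DigonAt h k) : Iso G G where
  vert := Equiv.refl _
  flag := D.perm
  root_flag x := by
    change G.root (D.perm x) = G.root x
    by_cases x1 : x = h
    · rw [x1, D.perm_left, D.root_eq]
    by_cases x2 : x = k
    · rw [x2, D.perm_right, D.root_eq]
    by_cases x3 : x = G.inv h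
    · rw [x3, D.perm_inv_left, D.root_inv_eq]
    by_cases x4 : x = G.inv k
    · rw [x4, D.perm_inv_right, D.root_inv_eq]
    rw [D.perm_of_ne x1 x2 x3 x4]
  inv_flag x := by
    by_cases x1 : x = h
    · rw [x1, D.perm_left, D.perm_inv_left]
    by_cases x2 : x = k
    · rw [x2, D.perm_right, D.perm_inv_right]
    by_cases x3 : x = G.inv h
    · rw [x3, D.perm_inv_left, G.inv_inv, G.inv_inv, D.perm_left]
    by_cases x4 : x = G.inv k
    · rw [x4, D.perm_inv_right, G.inv_inv, G.inv_inv, D.perm_right]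
    rw [D.perm_of_ne x1 x2 x3 x4, D.perm_of_ne]
    · exact fun h' => x3 (G.inv_eq_iff.mp h')
    · exact fun h' => x4 (G.inv_eq_iff.mp h')
    · exact fun h' => x1 (G.inv_injective h')
    · exact fun h' => x2 (G.inv_injective h')
  leg_flag i := by
    have h1 : ∀ y, G.inv y ≠ y → (G.leg i : G.Flag) ≠ y := fun y hy hl =>
      hy (by rw [← hl, G.inv_leg])
    have h2 : ∀ y, G.inv y ≠ y → (G.leg i : G.Flag) ≠ G.inv y := fun y hy hl =>
      h1 y hy (by rw [← G.inv_leg, hl, G.inv_inv])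
    exact D.perm_of_ne (h1 h D.inv_left_ne) (h1 k D.inv_right_ne) (h2 h D.inv_left_ne)
      (h2 k D.inv_right_ne)
  vgenus_vert _ := rfl

theorem DigonAt.swap_left (D : G.DigonAt h k) : D.swap.flag h = k := D.perm_left

theorem DigonAt.loc_eq (D : G.DigonAt h k) : G.loc h = G.loc k :=
  loc_eq_iff.mpr ⟨D.swap, Or.inl D.swap_left⟩

theorem DigonAt.root_flag (D : G.DigonAt h k) (φ : Iso G G) (x : G.Flag) :
    G.root (φ.flag x) = G.root x := by
  rcases D.aut φ with h1 | ⟨h1, h2, h3⟩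
  · rw [h1]
  by_cases x1 : x = h
  · rw [x1, h1, D.root_eq]
  by_cases x2 : x = k
  · rw [x2, h2, D.root_eq]
  by_cases x3 : x = G.inv h
  · rw [x3, φ.flag_inv, h1, D.root_inv_eq]
  by_cases x4 : x = G.inv k
  · rw [x4, φ.flag_inv, h2, D.root_inv_eq]
  rw [h3 x x1 x3 x2 x4]

/-- The edges and legs which are not exchanged with another one. -/
theorem DigonAt.flag_eq_or (D : G.DigonAt h k) {x : G.Flag} (hx : G.loc x ≠ G.loc h)
    (φ : Iso G G) : φ.flag x = x := by
  rcases D.aut φ with h1 | ⟨-, -, h3⟩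
  · exact h1 x
  refine h3 x ?_ ?_ ?_ ?_
  · rintro rfl
    exact hx rfl
  · rintro rfl
    exact hx (G.loc_inv h)
  · rintro rfl
    exact hx D.loc_eq.symm
  · rintro rfl
    exact hx ((G.loc_inv k).trans D.loc_eq.symm)

end DigonAt

/-- Automorphisms fix the vertices. -/
theorem HasKind.root_flag {G : LabelledGraph n} {K : Kind} (hK : G.HasKind K) (φ : Iso G G)
    (x : G.Flag) : G.root (φ.flag x) = G.root x := by
  cases K with
  | loop => exact hK.choose_spec.root_flag φ x
  | digon => exact hK.choose_spec.choose_spec.root_flag φ x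
  | rigid => exact congrArg _ (hK φ x)

/-- Every vertex carries a flag, and flags keep their root. Hence legs attached at different
vertices of a representative give non-isomorphic graphs. -/
theorem HasKind.vert_eq {G : LabelledGraph n} {K : Kind} (hK : G.HasKind K) (hG : G.Good)
    (φ : Iso G G) (v : G.Vert) : φ.vert v = v := by
  obtain ⟨x, rfl⟩ := (G.valence_pos_iff (v := v)).mp (by have := hG.three_le_valence v; omega)
  rw [← φ.root_flag, hK.root_flag]

/-! ### Counting the edges and legs up to automorphisms -/

open Classical in
theorem two_mul_card_loc {G : LabelledGraph n}
    (hG : ∀ (φ : Iso G G) x, φ.flag x = x ∨ φ.flag x = G.inv x) :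
    2 * Fintype.card G.Loc = Fintype.card G.Flag + n := by
  have key := two_mul_card_eq_of_involution (S := Finset.univ) (T := Finset.univ) (f := G.loc)
    G.inv_inv (fun _ _ => Finset.mem_univ _) (fun _ _ => Finset.mem_univ _)
    (fun x _ y _ => by
      refine ⟨fun h => ?_, loc_eq_of_eq_or⟩
      obtain ⟨φ, hφ⟩ := loc_eq_iff.mp h
      rcases hG φ x with h1 | h1 <;> rw [h1] at hφ
      · exact hφ.imp Eq.symm fun h2 => by rw [h2, G.inv_inv]
      · exact hφ.symm.imp (fun h2 => (G.inv_injective h2).symm) Eq.symm)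
    (fun q _ => ⟨q.out, Finset.mem_univ _, q.loc_out⟩)
  rwa [G.card_fixed] at key

open Classical in
theorem DigonAt.two_mul_card_loc {G : LabelledGraph n} {h k : G.Flag} (D : G.DigonAt h k) :
    2 * Fintype.card G.Loc + 2 = Fintype.card G.Flag + n := by
  -- Omitting one of the two exchanged edges leaves a set on which the fibres of `loc` are exactly
  -- the orbits of the involution.
  set S : Finset G.Flag := {k, G.inv k}ᶜ with hS
  have hmem : ∀ x, x ∈ S ↔ x ≠ k ∧ x ≠ G.inv k := fun x => by simp [hS]
  have key := two_mul_card_eq_of_involution (S := S) (T := Finset.univ) (f := G.loc)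
    G.inv_inv
    (fun x hx => by
      rw [hmem] at hx ⊢
      exact ⟨fun h1 => hx.2 (G.inv_eq_iff.mp h1), fun h1 => hx.1 (G.inv_injective h1)⟩)
    (fun _ _ => Finset.mem_univ _)
    (fun x hx y hy => by
      refine ⟨fun hxy => ?_, loc_eq_of_eq_or⟩
      rw [hmem] at hx hy
      obtain ⟨φ, hφ⟩ := loc_eq_iff.mp hxy
      have h1 : φ.flag x = x := by
        rcases D.aut φ with h1 | ⟨h1, h2, h3⟩
        · exact h1 x
        by_cases x1 : x = h
        · exfalso
          rw [x1, h1] at hφ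
          rcases hφ with h4 | h4
          · exact hy.1 h4.symm
          · exact hy.2 (G.inv_eq_iff.mp h4.symm)
        by_cases x2 : x = G.inv h
        · exfalso
          rw [x2, φ.flag_inv, h1] at hφ
          rcases hφ with h4 | h4
          · exact hy.2 h4.symm
          · exact hy.1 (G.inv_injective h4).symm
        exact h3 x x1 x2 hx.1 hx.2
      rw [h1] at hφ
      exact hφ.imp Eq.symm fun h2 => by rw [h2, G.inv_inv])
    (fun q _ => by
      by_cases hq : q.out = k ∨ q.out = G.inv k
      · refine ⟨h, (hmem h).mpr ⟨D.ne, D.inv_ne'.symm⟩, ?_⟩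
        rw [D.loc_eq, ← q.loc_out]
        exact loc_eq_of_eq_or hq
      · exact ⟨q.out, (hmem _).mpr (not_or.mp hq), q.loc_out⟩)
  have h1 : S.filter (fun x => G.inv x = x) = Finset.univ.filter fun x => G.inv x = x := by
    ext x
    simp only [Finset.mem_filter, hmem, Finset.mem_univ, true_and, and_iff_right_iff_imp]
    intro hx
    refine ⟨?_, ?_⟩
    · rintro rfl
      exact D.inv_right_ne hx
    · rintro rfl
      rw [G.inv_inv] at hx
      exact D.inv_right_ne hx.symm
  have h2 := Finset.card_compl_add_card ({k, G.inv k} : Finset G.Flag)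
  rw [Finset.card_pair D.inv_right_ne.symm, ← hS] at h2
  rw [h1, G.card_fixed, Finset.card_univ] at key
  omega

theorem Good.card_loc_rigid {G : LabelledGraph n} (hG : G.Good) (hR : G.Rigid) :
    Fintype.card G.Loc = Fintype.card G.Vert + n := by
  have h1 := two_mul_card_loc fun φ x => Or.inl (hR φ x)
  have h2 := hG.card_flag
  omega

theorem Good.card_loc_loop {G : LabelledGraph n} {h : G.Flag} (hG : G.Good) (L : G.LoopAt h) :
    Fintype.card G.Loc = Fintype.card G.Vert + n := by
  have h1 := two_mul_card_loc L.flag_eq_or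
  have h2 := hG.card_flag
  omega

/-- Of the V edges and n legs, exactly the two parallel edges are identified. -/
theorem Good.card_loc_digon {G : LabelledGraph n} {h k : G.Flag} (hG : G.Good)
    (D : G.DigonAt h k) : Fintype.card G.Loc + 1 = Fintype.card G.Vert + n := by
  have h1 := D.two_mul_card_loc
  have h2 := hG.card_flag
  omega

/-! ### Automorphisms of graphs with an inserted leg -/

theorem Iso.attach_flag_none {G H : LabelledGraph n} {v : G.Vert} {w : H.Vert}
    (ψ : Iso (G.attach v) (H.attach w)) :
    ψ.flag (none : Option G.Flag) = (none : Option H.Flag) := by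
  have h := ψ.leg_flag (Fin.last n)
  have h1 : ((G.attach v).leg (Fin.last n) : (G.attach v).Flag) = (none : Option G.Flag) :=
    G.attachLeg_last
  have h2 : ((H.attach w).leg (Fin.last n) : (H.attach w).Flag) = (none : Option H.Flag) :=
    H.attachLeg_last
  rwa [h1, h2] at h

theorem HasKind.attach {G : LabelledGraph n} {K : Kind} (hK : G.HasKind K) (v : G.Vert) :
    (G.attach v).HasKind K := by
  cases K with
  | loop =>
    obtain ⟨h, L⟩ := hK
    refine ⟨(some h : Option G.Flag), fun h' => L.inv_ne (Option.some_injective _ h'), L.root_inv,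
      fun ψ x hx hx' => ?_⟩
    obtain ⟨φ, -, hφ, -⟩ := ψ.exists_of_attach
    rcases x with _ | x
    · exact ψ.attach_flag_none
    · rw [hφ]
      exact congrArg some (L.aut φ x (fun h' => hx (congrArg some h'))
        fun h' => hx' (congrArg some h'))
  | digon =>
    obtain ⟨h, k, D⟩ := hK
    refine ⟨(some h : Option G.Flag), (some k : Option G.Flag),
      fun h' => D.inv_left_ne (Option.some_injective _ h'),
      fun h' => D.inv_right_ne (Option.some_injective _ h'),
      fun h' => D.ne (Option.some_injective _ h'),
      fun h' => D.inv_ne (Option.some_injective _ h'), D.root_eq, D.root_inv_eq, fun ψ => ?_⟩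
    obtain ⟨φ, -, hφ, -⟩ := ψ.exists_of_attach
    refine (D.aut φ).imp (fun h1 x => ?_) fun ⟨h1, h2, h3⟩ => ⟨?_, ?_, fun x x1 x2 x3 x4 => ?_⟩
    · rcases x with _ | x
      · exact ψ.attach_flag_none
      · rw [hφ, h1]
    · rw [hφ, h1]
    · rw [hφ, h2]
    · rcases x with _ | x
      · exact ψ.attach_flag_none
      · rw [hφ]
        exact congrArg some (h3 x (fun h' => x1 (congrArg some h'))
          (fun h' => x2 (congrArg some h')) (fun h' => x3 (congrArg some h'))
          fun h' => x4 (congrArg some h'))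
  | rigid =>
    intro ψ x
    obtain ⟨φ, -, hφ, -⟩ := ψ.exists_of_attach
    rcases x with _ | x
    · exact ψ.attach_flag_none
    · rw [hφ, hK φ x]

/-- The flags of the original graph in a graph with an inserted leg. -/
def oldFlag (G : LabelledGraph n) (h x : G.Flag) : (G.insertLeg h).Flag :=
  (some (Sum.inl x) : Option (G.Flag ⊕ Bool))

/-- The flags of the new vertex belonging to the subdivided edge or leg. -/
def newFlag (G : LabelledGraph n) (h : G.Flag) (b : Bool) : (G.insertLeg h).Flag :=
  (some (Sum.inr b) : Option (G.Flag ⊕ Bool))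

/-- The flag of the inserted leg. -/
def newLeg (G : LabelledGraph n) (h : G.Flag) : (G.insertLeg h).Flag :=
  (none : Option (G.Flag ⊕ Bool))

section InsertLeg

variable {G : LabelledGraph n} {h : G.Flag}

theorem oldFlag_injective (h : G.Flag) : Function.Injective (G.oldFlag h) :=
  (Option.some_injective _).comp Sum.inl_injective

theorem newFlag_ne (h : G.Flag) {b c : Bool} (hbc : b ≠ c) : G.newFlag h b ≠ G.newFlag h c :=
  fun h' => hbc (Sum.inr_injective (Option.some_injective _ h'))

theorem insertLeg_flag_cases {p : (G.insertLeg h).Flag → Prop} (h1 : ∀ x, p (G.oldFlag h x))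
    (h2 : ∀ b, p (G.newFlag h b)) (h3 : p (G.newLeg h)) : ∀ x, p x := by
  rintro (_ | x | b)
  · exact h3
  · exact h1 x
  · exact h2 b

theorem root_oldFlag (x : G.Flag) :
    (G.insertLeg h).root (G.oldFlag h x) = (some (G.root x) : Option G.Vert) := rfl

theorem inv_oldFlag {x : G.Flag} (h1 : x ≠ h) (h2 : x ≠ G.inv h) :
    (G.insertLeg h).inv (G.oldFlag h x) = G.oldFlag h (G.inv x) :=
  congrArg some (G.subdivInv_inl h1 h2)

theorem inv_newFlag_true : (G.insertLeg h).inv (G.newFlag h true) = G.oldFlag h h := rfl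

theorem inv_newFlag_false (hh : G.inv h ≠ h) :
    (G.insertLeg h).inv (G.newFlag h false) = G.oldFlag h (G.inv h) :=
  congrArg some (G.subdivInv_false hh)

theorem inv_oldFlag_self : (G.insertLeg h).inv (G.oldFlag h h) = G.newFlag h true := by
  rw [← inv_newFlag_true, inv_inv]

theorem inv_oldFlag_inv (hh : G.inv h ≠ h) :
    (G.insertLeg h).inv (G.oldFlag h (G.inv h)) = G.newFlag h false := by
  rw [← inv_newFlag_false hh, inv_inv]

theorem Iso.exists_of_insertLeg {H : LabelledGraph n} {k : H.Flag}
    (ψ : Iso (G.insertLeg h) (H.insertLeg k)) :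
    ∃ φ : Iso G H, (φ.flag h = k ∨ φ.flag h = H.inv k) ∧
      ∀ x, ψ.flag (G.oldFlag h x) = H.oldFlag k (φ.flag x) := by
  obtain ⟨χ, hχ, hf, -⟩ := Iso.exists_of_attach ψ
  obtain ⟨φ, hφ, hf', -⟩ := χ.exists_of_subdiv hχ
  exact ⟨φ, hφ, fun x => (hf _).trans (congrArg some (hf' x))⟩

theorem Iso.insertLeg_of_eq_or {H : LabelledGraph n} {k : H.Flag} (φ : Iso G H)
    (hk : φ.flag h = k ∨ φ.flag h = H.inv k) : Nonempty (Iso (G.insertLeg h) (H.insertLeg k)) := by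
  obtain ⟨ψ, hψ⟩ := φ.exists_subdiv hk
  exact ⟨ψ.attach hψ⟩

/-- Automorphisms of a graph with an inserted leg. -/
theorem Iso.exists_of_insertLeg_self (ψ : Iso (G.insertLeg h) (G.insertLeg h)) :
    ∃ φ : Iso G G, ψ.flag (G.newLeg h) = G.newLeg h ∧
      (∀ x, ψ.flag (G.oldFlag h x) = G.oldFlag h (φ.flag x)) ∧
      ((φ.flag h = h ∧ ∀ b, ψ.flag (G.newFlag h b) = G.newFlag h b) ∨
        (G.inv h ≠ h ∧ φ.flag h = G.inv h ∧ ∀ b, ψ.flag (G.newFlag h b) = G.newFlag h !b)) := by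
  obtain ⟨φ, hφ, hf⟩ := ψ.exists_of_insertLeg
  have hnone : ψ.flag (G.newLeg h) = G.newLeg h := Iso.attach_flag_none ψ
  refine ⟨φ, hnone, hf, ?_⟩
  have htrue : ψ.flag (G.newFlag h true) = (G.insertLeg h).inv (G.oldFlag h (φ.flag h)) := by
    rw [← inv_oldFlag_self, ψ.flag_inv, hf]
  -- The images of the old flags, of the new leg and of `newFlag h true` are already taken, so a
  -- single possibility remains for `newFlag h false`.
  have hfalse : ∀ b, ψ.flag (G.newFlag h true) = G.newFlag h b →
      ψ.flag (G.newFlag h false) = G.newFlag h !b := by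
    intro b hb
    have key : ∀ y, y = ψ.flag (G.newFlag h false) → y = G.newFlag h !b := by
      refine insertLeg_flag_cases (fun x hx => ?_) (fun c hc => ?_) fun hy => ?_
      · rw [← φ.flag.apply_symm_apply x, ← hf] at hx
        have := Option.some_injective _ (ψ.flag.injective hx)
        simp at this
      · congr 1
        by_contra hcb
        have hcb' : c = b :=
          (by decide : ∀ b c : Bool, ¬ (c = !b) → c = b) b c hcb
        rw [hcb', ← hb] at hc
        exact newFlag_ne h (by simp) (ψ.flag.injective hc)
      · rw [← hnone] at hy
        have := ψ.flag.injective hy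
        cases this
    exact key _ rfl
  by_cases h1 : φ.flag h = h
  · left
    rw [h1, inv_oldFlag_self] at htrue
    refine ⟨h1, ?_⟩
    rintro (_ | _)
    · exact hfalse _ htrue
    · exact htrue
  · right
    have h2 := hφ.resolve_left h1
    have h3 : G.inv h ≠ h := fun h3 => h1 (h2.trans h3)
    rw [h2, inv_oldFlag_inv h3] at htrue
    refine ⟨h3, h2, ?_⟩
    rintro (_ | _)
    · exact hfalse _ htrue
    · exact htrue

/-- Subdividing the loop gives two parallel edges between the old and the new vertex; a flip of the
loop becomes their exchange. -/
theorem LoopAt.insertLeg_self (L : G.LoopAt h) :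
    (G.insertLeg h).DigonAt (G.newFlag h true) (G.newFlag h false) where
  inv_left_ne h' := by cases Option.some_injective _ (inv_newFlag_true.symm.trans h')
  inv_right_ne h' := by cases Option.some_injective _ ((inv_newFlag_false L.inv_ne).symm.trans h')
  ne := newFlag_ne h (by simp)
  inv_ne h' := by cases Option.some_injective _ (inv_newFlag_true.symm.trans h')
  root_eq := rfl
  root_inv_eq := by
    rw [inv_newFlag_true, inv_newFlag_false L.inv_ne, root_oldFlag, root_oldFlag, L.root_inv]
  aut ψ := by
    obtain ⟨φ, hnone, hf, ⟨h1, h2⟩ | ⟨h0, h1, h2⟩⟩ := ψ.exists_of_insertLeg_self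
    · left
      refine insertLeg_flag_cases (fun x => ?_) h2 hnone
      rw [hf]
      congr 1
      by_cases x1 : x = h
      · rw [x1, h1]
      by_cases x2 : x = G.inv h
      · rw [x2, φ.flag_inv, h1]
      exact L.aut φ x x1 x2
    · right
      refine ⟨h2 true, h2 false, insertLeg_flag_cases (fun x x1 x2 x3 x4 => ?_)
        (fun b x1 x2 x3 x4 => ?_) fun _ _ _ _ => hnone⟩
      · rw [inv_newFlag_true] at x2
        rw [inv_newFlag_false L.inv_ne] at x4
        rw [hf, L.aut φ x (fun h' => x2 (congrArg _ h')) fun h' => x4 (congrArg _ h')]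
      · rcases b with _ | _
        · exact absurd rfl x3
        · exact absurd rfl x1

theorem LoopAt.insertLeg {k : G.Flag} (L : G.LoopAt h) (h1 : h ≠ k) (h2 : h ≠ G.inv k) :
    (G.insertLeg k).LoopAt (G.oldFlag k h) where
  inv_ne h' := by
    rw [inv_oldFlag h1 h2] at h'
    exact L.inv_ne (oldFlag_injective k h')
  root_inv := by
    rw [inv_oldFlag h1 h2, root_oldFlag, root_oldFlag, L.root_inv]
  aut ψ := by
    obtain ⟨φ, hnone, hf, h3⟩ := ψ.exists_of_insertLeg_self
    have h4 : φ.flag k = k := L.aut φ k h1.symm fun h' => h2 (by rw [h', G.inv_inv])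
    have h5 : ∀ b, ψ.flag (G.newFlag k b) = G.newFlag k b := by
      rcases h3 with h3 | h3
      · exact h3.2
      · exact absurd (h3.2.1.symm.trans h4) h3.1
    refine insertLeg_flag_cases (fun x x1 x2 => ?_) (fun b _ _ => h5 b) fun _ _ => hnone
    rw [inv_oldFlag h1 h2] at x2
    rw [hf, L.aut φ x (fun h' => x1 (congrArg _ h')) fun h' => x2 (congrArg _ h')]

theorem Rigid.insertLeg (hG : G.Rigid) (k : G.Flag) : (G.insertLeg k).Rigid := by
  intro ψ
  obtain ⟨φ, hnone, hf, h3⟩ := ψ.exists_of_insertLeg_self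
  have h5 : ∀ b, ψ.flag (G.newFlag k b) = G.newFlag k b := by
    rcases h3 with h3 | h3
    · exact h3.2
    · exact absurd (h3.2.1.symm.trans (hG φ k)) h3.1
  exact insertLeg_flag_cases (fun x => by rw [hf, hG φ x]) h5 hnone

/-- The leg inserted on one of the parallel edges distinguishes it from the other: an automorphism
has to preserve the subdivided edge, which excludes the exchange. -/
theorem DigonAt.rigid_insertLeg {k : G.Flag} (D : G.DigonAt h k) {l : G.Flag}
    (hl : G.loc l = G.loc h) : (G.insertLeg l).Rigid := by
  intro ψ
  obtain ⟨φ, hnone, hf, h3⟩ := ψ.exists_of_insertLeg_self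
  have key : ∀ x, φ.flag x = x := by
    have h4 : φ.flag l = l ∨ φ.flag l = G.inv l := h3.imp And.left fun h => h.2.1
    obtain ⟨χ, hχ⟩ := loc_eq_iff.mp hl.symm
    refine (D.aut φ).resolve_right ?_
    rintro ⟨h1, h2, -⟩
    have h5 : φ.flag (χ.flag h) = χ.flag h ∨ φ.flag (χ.flag h) = G.inv (χ.flag h) := by
      rcases hχ with hχ | hχ <;> rw [hχ]
      · exact h4
      · rw [φ.flag_inv]
        exact h4.imp (congrArg _) (congrArg _)
    rcases D.aut χ with h6 | ⟨h6, -, -⟩ <;> rw [h6] at h5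
    · rw [h1] at h5
      exact h5.elim D.ne.symm D.inv_ne.symm
    · rw [h2] at h5
      exact h5.elim D.ne D.inv_ne'.symm
  have h5 : ∀ b, ψ.flag (G.newFlag l b) = G.newFlag l b := by
    rcases h3 with h3 | h3
    · exact h3.2
    · exact absurd (h3.2.1.symm.trans (key l)) h3.1
  exact insertLeg_flag_cases (fun x => by rw [hf, key]) h5 hnone

theorem DigonAt.insertLeg {k l : G.Flag} (D : G.DigonAt h k) (hl : G.loc l ≠ G.loc h) :
    (G.insertLeg l).DigonAt (G.oldFlag l h) (G.oldFlag l k) := by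
  have h1 : h ≠ l := by
    rintro rfl
    exact hl rfl
  have h2 : h ≠ G.inv l := by
    rintro rfl
    exact hl (G.loc_inv l).symm
  have h3 : k ≠ l := by
    rintro rfl
    exact hl D.loc_eq.symm
  have h4 : k ≠ G.inv l := by
    rintro rfl
    exact hl (D.loc_eq.trans (G.loc_inv l)).symm
  refine ⟨fun h' => ?_, fun h' => ?_, fun h' => D.ne (oldFlag_injective l h'), fun h' => ?_, ?_, ?_,
    fun ψ => ?_⟩
  · rw [inv_oldFlag h1 h2] at h'
    exact D.inv_left_ne (oldFlag_injective l h')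
  · rw [inv_oldFlag h3 h4] at h'
    exact D.inv_right_ne (oldFlag_injective l h')
  · rw [inv_oldFlag h1 h2] at h'
    exact D.inv_ne (oldFlag_injective l h')
  · rw [root_oldFlag, root_oldFlag, D.root_eq]
  · rw [inv_oldFlag h1 h2, inv_oldFlag h3 h4, root_oldFlag, root_oldFlag, D.root_inv_eq]
  · obtain ⟨φ, hnone, hf, h5⟩ := ψ.exists_of_insertLeg_self
    have h6 : ∀ b, ψ.flag (G.newFlag l b) = G.newFlag l b := by
      rcases h5 with h5 | h5
      · exact h5.2
      · exact absurd (h5.2.1.symm.trans (D.flag_eq_or hl φ)) h5.1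
    refine (D.aut φ).imp
      (fun h7 => insertLeg_flag_cases (fun x => by rw [hf, h7]) h6 hnone)
      fun ⟨h7, h8, h9⟩ => ⟨by rw [hf, h7], by rw [hf, h8],
        insertLeg_flag_cases (fun x x1 x2 x3 x4 => ?_) (fun b _ _ _ _ => h6 b)
          fun _ _ _ _ => hnone⟩
    rw [inv_oldFlag h1 h2] at x2
    rw [inv_oldFlag h3 h4] at x4
    rw [hf, h9 x (fun h' => x1 (congrArg _ h')) (fun h' => x2 (congrArg _ h'))
      (fun h' => x3 (congrArg _ h')) fun h' => x4 (congrArg _ h')]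

end InsertLeg

open Classical in
/-- There is exactly one edge, up to automorphisms, whose subdivision changes the kind. -/
theorem HasKind.exists_loc {G : LabelledGraph n} {K : Kind} (hK : G.HasKind K) (hG : G.Good) :
    ∃ q₀ : G.Loc, ∀ q : G.Loc, (G.insertLeg q.out).HasKind (if q = q₀ then K.next else K) := by
  cases K with
  | loop =>
    obtain ⟨h, L⟩ := hK
    refine ⟨G.loc h, fun q => ?_⟩
    by_cases h1 : h = q.out
    · rw [if_pos (by rw [h1, q.loc_out])]
      exact ⟨_, _, (h1 ▸ L).insertLeg_self⟩
    by_cases h2 : h = G.inv q.out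
    · rw [if_pos (by rw [h2, loc_inv, q.loc_out])]
      have h3 : G.inv h = q.out := by rw [h2, G.inv_inv]
      exact ⟨_, _, (h3 ▸ L.inv).insertLeg_self⟩
    rw [if_neg]
    · exact ⟨_, L.insertLeg h1 h2⟩
    · intro hq
      rw [← q.loc_out] at hq
      obtain ⟨φ, hφ⟩ := loc_eq_iff.mp hq.symm
      rcases L.flag_eq_or φ h with h3 | h3 <;> rw [h3] at hφ
      · exact hφ.elim h1 h2
      · exact hφ.elim (fun h4 => h2 (G.inv_eq_iff.mp h4)) fun h4 => h1 (G.inv_injective h4)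
  | digon =>
    obtain ⟨h, k, D⟩ := hK
    refine ⟨G.loc h, fun q => ?_⟩
    by_cases hq : q = G.loc h
    · rw [if_pos hq]
      exact D.rigid_insertLeg (q.loc_out.trans hq)
    · rw [if_neg hq]
      exact ⟨_, _, D.insertLeg (by rwa [q.loc_out])⟩
  | rigid =>
    obtain ⟨v⟩ := G.nonempty
    obtain ⟨x, -⟩ := (G.valence_pos_iff (v := v)).mp
      (by have := hG.three_le_valence v; omega)
    -- Any class will do, as `Kind.rigid.next` is `Kind.rigid`; a flag exists because valences are
    -- at least 3.
    refine ⟨G.loc x, fun q => ?_⟩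
    have : (if q = G.loc x then Kind.rigid.next else Kind.rigid) = Kind.rigid := by
      split_ifs <;> rfl
    rw [this]
    exact Rigid.insertLeg hK _

theorem loopAt_loopGraph : ∃ h, loopGraph.LoopAt h := by
  refine ⟨(some true : Option Bool), fun h => ?_, rfl, fun φ x h1 h2 => ?_⟩
  · cases h
  · rcases x with _ | _ | _
    · exact Iso.attach_flag_none φ
    · exact absurd rfl h2
    · exact absurd rfl h1

/-! ### Representatives of the isomorphism classes and their generating polynomials. -/

/-- A finite family of representatives of the isomorphism classes of stable graphs of genus `1`
all of whose vertices have genus `0`. -/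
structure Transversal (n : ℕ) where
  ι : Type
  [fintype : Fintype ι]
  graph : ι → LabelledGraph n
  -- The kind is a label attached as data, so the counts by kind do not depend on the three kinds
  -- excluding one another.
  kind : ι → Kind
  good : ∀ i, (graph i).Good
  hasKind : ∀ i, (graph i).HasKind (kind i)
  eq_of_iso : ∀ i j, Iso (graph i) (graph j) → i = j
  exists_iso : ∀ G : LabelledGraph n, G.Good → ∃ i, Nonempty (Iso (graph i) G)

/-- The vertex of the last leg has valence at least 4 on the left and exactly 3 on the right. -/
theorem isEmpty_iso_attach_insertLeg {G H : LabelledGraph n} (hG : G.Good) (v : G.Vert)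
    (h : H.Flag) : IsEmpty (Iso (G.attach v) (H.insertLeg h)) := by
  classical
  refine ⟨fun ψ => ?_⟩
  have h1 : ψ.vert v = (none : Option H.Vert) :=
    (ψ.root_flag (none : Option G.Flag)).symm.trans
      (congrArg (H.insertLeg h).root (Iso.attach_flag_none ψ))
  have h2 := ψ.valence_vert v
  rw [h1, valence_insertLeg_none, valence_attach, if_pos rfl] at h2
  have h3 := hG.three_le_valence v
  omega

namespace Transversal

attribute [instance] Transversal.fintype

/-- The family consisting of the graph with one loop and one leg. -/
noncomputable def one : Transversal 1 where
  ι := Unit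
  graph _ := loopGraph
  kind _ := Kind.loop
  good _ := good_loopGraph
  hasKind _ := loopAt_loopGraph
  eq_of_iso _ _ _ := rfl
  exists_iso _ hG := ⟨(), hG.nonempty_iso_of_one⟩

variable (T : Transversal n)

/-- The edge of a representative whose subdivision changes the kind. -/
noncomputable def special (i : T.ι) : (T.graph i).Loc :=
  ((T.hasKind i).exists_loc (T.good i)).choose

/-- The graphs obtained from a representative by inserting a leg. -/
noncomputable def insertGraph (i : T.ι) : (T.graph i).Vert ⊕ (T.graph i).Loc → LabelledGraph (n + 1)
  | Sum.inl v => (T.graph i).attach v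
  | Sum.inr q => (T.graph i).insertLeg q.out

open Classical in
/-- The kinds of the graphs obtained from a representative by inserting a leg. -/
noncomputable def insertKind (i : T.ι) : (T.graph i).Vert ⊕ (T.graph i).Loc → Kind
  | Sum.inl _ => T.kind i
  | Sum.inr q => if q = T.special i then (T.kind i).next else T.kind i

/-- The family of the graphs with an inserted leg. -/
noncomputable def succ (hn : 1 ≤ n) : Transversal (n + 1) where
  ι := Σ i, (T.graph i).Vert ⊕ (T.graph i).Loc
  graph x := T.insertGraph x.1 x.2
  kind x := T.insertKind x.1 x.2
  good := by
    rintro ⟨i, v | q⟩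
    · exact (T.good i).attach v
    · exact good_insertLeg_iff.mpr (T.good i)
  hasKind := by
    rintro ⟨i, v | q⟩
    · exact (T.hasKind i).attach v
    · exact ((T.hasKind i).exists_loc (T.good i)).choose_spec q
  eq_of_iso := by
    rintro ⟨i, v | q⟩ ⟨j, w | r⟩ ψ
    · obtain ⟨φ, hφ, -⟩ := Iso.exists_of_attach ψ
      obtain rfl := T.eq_of_iso i j φ
      rw [(T.hasKind i).vert_eq (T.good i)] at hφ
      rw [hφ]
    · exact ((isEmpty_iso_attach_insertLeg (T.good i) v r.out).false ψ).elim
    · exact ((isEmpty_iso_attach_insertLeg (T.good j) w q.out).false ψ.symm).elim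
    · obtain ⟨φ, hφ, -⟩ := Iso.exists_of_insertLeg ψ
      obtain rfl := T.eq_of_iso i j φ
      rw [← q.loc_out, ← r.loc_out, loc_eq_iff.mpr ⟨φ, hφ⟩]
  exists_iso G hG := by
    rcases hG.exists_iso hn with ⟨H, hH, v, ⟨ψ⟩⟩ | ⟨H, hH, h, ⟨ψ⟩⟩
    · obtain ⟨i, ⟨φ⟩⟩ := T.exists_iso H hH
      exact ⟨⟨i, Sum.inl (φ.vert.symm v)⟩,
        ⟨(φ.attach (φ.vert.apply_symm_apply v)).trans ψ⟩⟩
    · obtain ⟨i, ⟨φ⟩⟩ := T.exists_iso H hH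
      refine ⟨⟨i, Sum.inr ((T.graph i).loc (φ.flag.symm h))⟩, ?_⟩
      -- The flag chosen by `out` agrees with the desired one only up to an automorphism `α` and
      -- reversal, which does not affect the resulting graph up to isomorphism.
      obtain ⟨α, hα⟩ := loc_eq_iff.mp ((T.graph i).loc (φ.flag.symm h)).loc_out
      obtain ⟨χ⟩ := (α.trans φ).insertLeg_of_eq_or (h := ((T.graph i).loc (φ.flag.symm h)).out)
        (k := h) (by
          change φ.flag (α.flag _) = h ∨ φ.flag (α.flag _) = H.inv h
          refine hα.imp (fun h1 => ?_) fun h1 => ?_ <;> rw [h1]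
          · exact φ.flag.apply_symm_apply h
          · rw [φ.flag_inv, φ.flag.apply_symm_apply])
      exact ⟨χ.trans ψ⟩

open Classical in
/-- The contribution of a representative to the generating polynomial of a kind. -/
noncomputable def term (k : Kind) (i : T.ι) : Polynomial ℚ :=
  if T.kind i = k then Polynomial.X ^ Fintype.card (T.graph i).Vert else 0

/-- The polynomial counting the representatives of a kind by vertices. -/
noncomputable def gf (k : Kind) : Polynomial ℚ := ∑ i, T.term k i

-- The three summands come from the vertices, from the positions that keep the kind, and from the
-- one special position that passes to the next kind.
open Classical in
theorem gf_succ (hn : 1 ≤ n) (k : Kind) :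
    (T.succ hn).gf k = ∑ i, ((Fintype.card (T.graph i).Vert : Polynomial ℚ) * T.term k i
      + (((Fintype.card (T.graph i).Loc : Polynomial ℚ) - 1) * Polynomial.X * T.term k i
        + if (T.kind i).next = k then
            Polynomial.X * Polynomial.X ^ Fintype.card (T.graph i).Vert else 0)) := by
  refine (Fintype.sum_sigma fun x : Σ i, (T.graph i).Vert ⊕ (T.graph i).Loc =>
    (T.succ hn).term k x).trans (Finset.sum_congr rfl fun i _ => ?_)
  refine (Fintype.sum_sum_type fun x : (T.graph i).Vert ⊕ (T.graph i).Loc =>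
    (T.succ hn).term k ⟨i, x⟩).trans (congrArg₂ (· + ·) ?_ ?_)
  · refine (Finset.sum_const (T.term k i)).trans ?_
    rw [Finset.card_univ, nsmul_eq_mul]
  · have h1 : ∀ q : (T.graph i).Loc, (T.succ hn).term k ⟨i, Sum.inr q⟩ =
        if q = T.special i then (if (T.kind i).next = k then
            Polynomial.X * Polynomial.X ^ Fintype.card (T.graph i).Vert else 0)
          else Polynomial.X * T.term k i := by
      intro q
      have h2 : Fintype.card ((T.graph i).insertLeg q.out).Vert = _ := card_insertLeg_vert _ _
      change (if (if q = T.special i then (T.kind i).next else T.kind i) = k then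
        Polynomial.X ^ Fintype.card ((T.graph i).insertLeg q.out).Vert else 0) = _
      rw [h2, pow_succ', term]
      split_ifs <;> simp
    refine (Finset.sum_congr rfl fun q _ => h1 q).trans ?_
    rw [Fintype.sum_eq_add_sum_compl (T.special i), if_pos rfl, add_comm]
    congr 1
    rw [Finset.sum_congr rfl (g := fun _ => Polynomial.X * T.term k i) (fun q hq => if_neg (by
      simpa using hq)), Finset.sum_const, Finset.card_compl, Finset.card_singleton, nsmul_eq_mul,
      Nat.cast_sub (Fintype.card_pos_iff.mpr ⟨T.special i⟩)]
    push_cast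
    ring

/-- The Euler operator multiplies by the number of vertices; this turns the counts of positions into
differential operators on `gf`. -/
theorem X_mul_derivative_term (k : Kind) (i : T.ι) :
    Polynomial.X * Polynomial.derivative (T.term k i) =
      (Fintype.card (T.graph i).Vert : Polynomial ℚ) * T.term k i := by
  unfold term
  split_ifs
  · rw [Polynomial.derivative_X_pow]
    cases Fintype.card (T.graph i).Vert with
    | zero => simp
    | succ m =>
      rw [Nat.add_sub_cancel, Polynomial.C_eq_natCast, pow_succ]
      ring
  · simp

theorem X_mul_derivative_gf (k : Kind) :
    Polynomial.X * Polynomial.derivative (T.gf k) =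
      ∑ i, (Fintype.card (T.graph i).Vert : Polynomial ℚ) * T.term k i := by
  rw [gf, Polynomial.derivative_sum, Finset.mul_sum]
  exact Finset.sum_congr rfl fun i _ => T.X_mul_derivative_term k i

/-- All V + n positions but the loop itself preserve the kind, which accounts for the subtracted
term. -/
theorem gf_loop_succ (hn : 1 ≤ n) : (T.succ hn).gf Kind.loop =
    Polynomial.X * (1 + Polynomial.X) * Polynomial.derivative (T.gf Kind.loop)
      + (n : Polynomial ℚ) * Polynomial.X * T.gf Kind.loop - Polynomial.X * T.gf Kind.loop := by
  rw [mul_right_comm, X_mul_derivative_gf, gf_succ, gf, Finset.sum_mul, Finset.mul_sum,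
    Finset.mul_sum, ← Finset.sum_add_distrib, ← Finset.sum_sub_distrib]
  refine Finset.sum_congr rfl fun i _ => ?_
  have hK := T.hasKind i
  unfold term
  cases hk : T.kind i <;> rw [hk] at hK
  · obtain ⟨h, L⟩ := hK
    rw [(T.good i).card_loc_loop L]
    simp [Kind.next]
    ring
  · simp [Kind.next]
  · simp [Kind.next]

theorem gf_digon_succ (hn : 1 ≤ n) : (T.succ hn).gf Kind.digon =
    Polynomial.X * (1 + Polynomial.X) * Polynomial.derivative (T.gf Kind.digon)
      + (n : Polynomial ℚ) * Polynomial.X * T.gf Kind.digon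
      - (2 * Polynomial.X) * T.gf Kind.digon + Polynomial.X * T.gf Kind.loop := by
  rw [mul_right_comm, X_mul_derivative_gf, gf_succ, gf, gf, Finset.sum_mul, Finset.mul_sum,
    Finset.mul_sum, Finset.mul_sum, ← Finset.sum_add_distrib, ← Finset.sum_sub_distrib,
    ← Finset.sum_add_distrib]
  refine Finset.sum_congr rfl fun i _ => ?_
  have hK := T.hasKind i
  unfold term
  cases hk : T.kind i <;> rw [hk] at hK
  · simp [Kind.next]
  · obtain ⟨h, k, D⟩ := hK
    have h1 := (T.good i).card_loc_digon D
    have h2 : (Fintype.card (T.graph i).Loc : Polynomial ℚ) =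
        Fintype.card (T.graph i).Vert + n - 1 := by
      rw [eq_sub_iff_add_eq]
      exact_mod_cast h1
    rw [h2]
    simp [Kind.next]
    ring
  · simp [Kind.next]

theorem gf_rigid_succ (hn : 1 ≤ n) : (T.succ hn).gf Kind.rigid =
    Polynomial.X * (1 + Polynomial.X) * Polynomial.derivative (T.gf Kind.rigid)
      + (n : Polynomial ℚ) * Polynomial.X * T.gf Kind.rigid + Polynomial.X * T.gf Kind.digon := by
  rw [mul_right_comm, X_mul_derivative_gf, gf_succ, gf, gf, Finset.sum_mul, Finset.mul_sum,
    Finset.mul_sum, ← Finset.sum_add_distrib, ← Finset.sum_add_distrib]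
  refine Finset.sum_congr rfl fun i _ => ?_
  have hK := T.hasKind i
  unfold term
  cases hk : T.kind i <;> rw [hk] at hK
  · simp [Kind.next]
  · simp [Kind.next]
  · rw [(T.good i).card_loc_rigid hK]
    simp [Kind.next]
    ring

theorem eval_one_gf :
    (T.gf Kind.loop + T.gf Kind.digon + T.gf Kind.rigid).eval 1 = Fintype.card T.ι := by
  rw [gf, gf, gf, ← Finset.sum_add_distrib, ← Finset.sum_add_distrib, Polynomial.eval_finsetSum,
    Finset.sum_congr rfl (g := fun _ => (1 : ℚ))]
  · simp
  · intro i _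
    unfold term
    cases T.kind i <;> simp

/-- The isomorphism class of a representative. -/
noncomputable def toClass (i : T.ι) : StableGraphClass 1 n :=
  Quotient.mk _ ⟨T.graph i, (good_iff.mp (T.good i)).1⟩

theorem toClass_injective : Function.Injective T.toClass := fun i j h =>
  T.eq_of_iso i j (Quotient.exact h).some

theorem range_toClass : Set.range T.toClass = genusZeroVertexClasses 1 n := by
  ext c
  constructor
  · rintro ⟨i, rfl⟩
    exact ⟨_, rfl, (T.good i).vgenus_eq⟩
  · rintro ⟨G, rfl, hG⟩
    obtain ⟨i, hi⟩ := T.exists_iso G.1 (good_iff.mpr ⟨G.2, hG⟩)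
    exact ⟨i, Quotient.sound hi⟩

theorem ncard_classes : (genusZeroVertexClasses 1 n).ncard = Fintype.card T.ι := by
  rw [← T.range_toClass, ← Nat.card_coe_set_eq, Nat.card_range_of_injective T.toClass_injective,
    Nat.card_eq_fintype_card]

theorem finite_classes (T : Transversal n) : (genusZeroVertexClasses 1 n).Finite := by
  rw [← T.range_toClass]
  exact Set.finite_range _

open Classical in
theorem gf_one (k : Kind) :
    one.gf k = if Kind.loop = k then Polynomial.X else 0 := by
  refine (Fintype.sum_unique fun i : Unit => one.term k i).trans ?_
  have h : Fintype.card loopGraph.Vert = 1 := rfl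
  change (if Kind.loop = k then (Polynomial.X : Polynomial ℚ) ^ Fintype.card loopGraph.Vert else 0) = _
  rw [h, pow_one]

/-- Representatives of the stable graphs with at least one leg. -/
noncomputable def std : ∀ n, Transversal (n + 1)
  | 0 => one
  | n + 1 => (std n).succ (Nat.le_add_left 1 n)

/-- The polynomials counting the graphs of a given kind by vertices. -/
noncomputable def stdGf (k : Kind) : ℕ → Polynomial ℚ
  | 0 => 0
  | n + 1 => (std n).gf k

/-- The step from 0 to 1 is the initial condition, a single graph with one vertex and one loop;
insertion of legs starts at one leg. -/
theorem legRecurrence : LegRecurrence (stdGf Kind.loop) (stdGf Kind.digon)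
    (fun n => stdGf Kind.loop n + stdGf Kind.digon n + stdGf Kind.rigid n) where
  loop_zero := rfl
  digon_zero := rfl
  total_zero := by simp [stdGf]
  loop_succ n := by
    classical
    cases n with
    | zero => simp [stdGf, std, gf_one]
    | succ n => simp [stdGf, std, gf_loop_succ]
  digon_succ n := by
    classical
    cases n with
    | zero => simp [stdGf, std, gf_one]
    | succ n => simp [stdGf, std, gf_digon_succ]
  total_succ n := by
    classical
    cases n with
    | zero => simp [stdGf, std, gf_one]
    | succ n =>
      simp only [stdGf, std, gf_loop_succ, gf_digon_succ, gf_rigid_succ, map_add]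
      simp
      ring

end Transversal

end LabelledGraph

theorem mainTheorem6 :
    (∀ n : ℕ, 1 ≤ n → (genusZeroVertexClasses 1 n).Finite) ∧
    PowerSeries.mk (fun n : ℕ =>
        if 1 ≤ n then ((genusZeroVertexClasses 1 n).ncard : ℚ) / (n.factorial : ℚ) else 0) =
      PowerSeries.subst innerSeriesInv outerSeries := by
  refine ⟨fun n hn => ?_, ?_⟩
  · obtain ⟨m, rfl⟩ := Nat.exists_eq_add_of_le' hn
    exact (LabelledGraph.Transversal.std m).finite_classes
  -- At t = 1 each representative has weight 1, so the coefficients count isomorphism classes.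
  · rw [← LabelledGraph.Transversal.legRecurrence.specialize_total]
    ext1 n
    rw [PowerSeries.coeff_mk, specialize, PowerSeries.coeff_map, egf, PowerSeries.coeff_mk,
      Polynomial.coe_evalRingHom, Polynomial.eval_mul, Polynomial.eval_C]
    cases n with
    | zero => simp [LabelledGraph.Transversal.stdGf]
    | succ m =>
      have h := (LabelledGraph.Transversal.std m).eval_one_gf
      rw [← (LabelledGraph.Transversal.std m).ncard_classes] at h
      rw [if_pos (Nat.le_add_left 1 m), div_eq_inv_mul, ← h]
      rfl
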